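/- Let $A$ be a finite alphabet. A key is a finite word over $A\cup\{\leftarrow\}$. It acts on words over $A$ by carrying out its symbols from first to last: a letter $a\in A$ turns $u$ into $ua$, and the backspace $\leftarrow$ turns $ua$ into $u$ (for $a \in A$) and leaves the empty word $\varepsilon$ unchanged. A $\mathsf{BK}$ keyboard over $A$ is a finite set $K$ of keys. Its language $\mathcal L(K)\subseteq A^*$ is the set of words obtained from $\varepsilon$ by applying a non-empty finite sequence of keys of $K$. The keyboard $K$ is universal if $\mathcal L(K)=A^*$. Let $\|K\|_\infty=\max_{t\in K}|t|$ be the maximal length of a key of $K$ (with $\|\emptyset\|_\infty=0$). The following hold. 1. The universality problem for $\mathsf{BK}$ keyboards over $A$ (given $K$, written as a list of its keys with every key followed by an end marker, so that $K$ has size $\sum_{t\in K}(|t|+1)$ if no key is repeated, decide whether $\mathcal L(K)=A^*$) is in $\mathsf{coNP}$. 2. If a $\mathsf{BK}$ keyboard $K$ over $A$ is not universal, then there is a word $w\in A^*$ of length at most $\|K\|_\infty+1$ with $w\notin\mathcal L(K)$. -/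

import Mathlib

namespace Keyboards

/-- Atomic operations over the alphabet `A`: the letters of `A` together with the
backspace, the left arrow and the right arrow. -/
inductive Op (A : Type) : Type
  | letter (a : A)
  | backspace
  | left
  | right

/-- A key is a finite sequence of atomic operations. -/
abbrev Key (A : Type) : Type := List (Op A)

/-- A configuration `⟨u|v⟩`: the word `u` to the left of the cursor and the word `v` to the
right of it, both written from left to right. -/
abbrev Config (A : Type) : Type := List A × List A

/-- The action of an atomic operation on a configuration.  An operation that meets the edge of
the written word leaves the configuration unchanged (note `[].dropLast = []`). -/
def Op.act {A : Type} : Op A → Config A → Config A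
  | .letter a, (u, v) => (u ++ [a], v)
  | .backspace, (u, v) => (u.dropLast, v)
  | .left, (u, v) =>
      match u.getLast? with
      | none => (u, v)
      | some a => (u.dropLast, a :: v)
  | .right, (u, v) =>
      match v with
      | [] => (u, [])
      | a :: v' => (u ++ [a], v')

/-- The action of a key: its operations are applied from first to last. -/
def Key.act {A : Type} (t : Key A) (c : Config A) : Config A :=
  t.foldl (fun c σ => σ.act c) c

/-- The action of a sequence of keys, applied from first to last. -/
def actSeq {A : Type} (τ : List (Key A)) (c : Config A) : Config A :=
  τ.foldl (fun c t => Key.act t c) c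

/-- An automatic keyboard is a finite set of keys. -/
abbrev AutomaticKeyboard (A : Type) : Type := Finset (Key A)

namespace AutomaticKeyboard

/-- The language of an automatic keyboard: all words `uv` such that some non-empty sequence of
keys of `K` leads from the empty configuration to `⟨u|v⟩`. -/
def language {A : Type} (K : AutomaticKeyboard A) : Language A :=
  {w | ∃ τ : List (Key A), τ ≠ [] ∧ (∀ t ∈ τ, t ∈ K) ∧
    ∃ u v : List A, actSeq τ ([], []) = (u, v) ∧ w = u ++ v}

/-- `K` is universal if it recognizes every word. -/
def Universal {A : Type} (K : AutomaticKeyboard A) : Prop :=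
  ∀ w : List A, w ∈ K.language

/-- The class `BK`: automatic keyboards whose keys only write letters and use the backspace. -/
def IsBK {A : Type} (K : AutomaticKeyboard A) : Prop :=
  ∀ t ∈ K, Op.left ∉ t ∧ Op.right ∉ t

/-- `‖K‖∞`, the maximal length of a key of `K` (and `0` if `K` has no key). -/
def normInf {A : Type} (K : AutomaticKeyboard A) : ℕ := K.sup List.length

end AutomaticKeyboard

/-- A list of keys written as a string: every key is followed by the end marker `none`.  The
length of the string is the sum of `|t| + 1` over the keys `t` in the list. -/
def encodeKeys {A : Type} (l : List (Key A)) : List (Option (Op A)) :=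
  l.flatMap fun t => t.map some ++ [none]

/-- The universality problem for `BK` keyboards over the alphabet `A`, as a language: the strings
which list the keys of a universal `BK` keyboard, in any order.  All other strings, including
those that do not encode a list of keys, are outside of it. -/
def bkUniversality (A : Type) : Set (List (Option (Op A))) :=
  {x | ∃ (K : AutomaticKeyboard A) (l : List (Key A)), (∀ t, t ∈ l ↔ t ∈ K) ∧
    x = encodeKeys l ∧ K.IsBK ∧ K.Universal}

end Keyboards

namespace Complexity

/-- A pair of words as a single word, each letter being tagged with the component that it
comes from. -/
def encodePair {S C : Type} (z : List S × List C) : List (S ⊕ C) :=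
  z.1.map Sum.inl ++ z.2.map Sum.inr

/-- The class `NP` of languages over the alphabet `S`: there are a finite alphabet `C` of
certificates, a polynomial `p` and a verifier `V` computed in polynomial time by a Turing
machine, such that `x ∈ L` iff `V` accepts `x` together with some certificate of length at most
`p(|x|)`. -/
def InNP {S : Type} (L : Set (List S)) : Prop :=
  ∃ (C : Type) (_ : Finite C) (p : Polynomial ℕ) (V : List S × List C → Bool),
    Nonempty (Turing.TM2ComputableInPolyTime encodePair Computability.encodeBool V) ∧
    ∀ x : List S, x ∈ L ↔ ∃ y : List C, y.length ≤ p.eval x.length ∧ V (x, y) = true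

/-- The class `coNP`: languages with complement in `NP`. -/
def InCoNP {S : Type} (L : Set (List S)) : Prop := InNP Lᶜ

end Complexity

/-!
A letter followed by a backspace has no effect, so a key without arrows amounts to `n` backspaces
followed by a word `v`, where `n + |v|` is at most the length of the key. This makes short words
decide universality: in a run to a word `u` of length `‖K‖∞ + 1`, after the last key which replaces
the whole content, leaving a word `v` with `|v| ≤ ‖K‖∞`, the rest of the run never touches anything
below, so it also leads from `y ++ v` to `y ++ u` for every `y` (`exists_liftable_run`). By
induction on the length, all words are recognized if those of length at most `‖K‖∞ + 1` are
(`AutomaticKeyboard.IsBK.universal_of_short`).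

For membership in `coNP`, the certificate of non-universality consists of a word `w` and an
inductive invariant which separates `w` from the runs. A content is abstracted to its position
`(i, h)` relative to `w`: it agrees with `w` on exactly the first `i` letters and has `h` further
letters. The operations act on positions (`track`), and `w` itself has the position `(|w|, 0)`. The
certificate gives, for every `i` and for all `h` up to a bound, a bit telling whether `(i, h)` is
safe; the verifier checks that `(0, 0)` is safe and that every key leads from safe positions to safe
positions other than `(|w|, 0)`, ignoring heights above the bound. For a word outside of the
language, the positions that fit a reachable content can be taken as the safe ones
(`exists_verdict_of_notMem`). Conversely, ignoring large heights is justified by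
`lowReach_of_trackAll`: at heights of at least `M = ‖K‖∞` every key merely adds its weight, so the
keys of an excursion can be reordered, growing keys being used below `2 * M` and shrinking keys
above, and then no height above `4 * M` occurs (`verdict_ne_true_of_mem`).

The verifier is a Turing machine which keeps the bits in a list of cells, row after row. A letter
shifts the marks of the current set of positions to the right, a backspace shifts them to the left,
so each symbol of the input is treated by a finite-state pass from left to right and one from right
to left over the cells. In each pass from right to left, four more cells of every row are crossed
out, which verifies that the rows are at least four times as long as the input. Machines of this
kind run in quadratic time (`SweepMachine.Data.polyTime`).
-/

/-! ### Two-pass sweep machines -/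

namespace SweepMachine

/-- Run the letter-to-letter transducer `f` from the control state `q` along a list, as a
machine does which pops the list from one stack and pushes the output onto another one: the
output appears in reverse order, on top of the initial content `acc` of the second stack. -/
def pass {Q W : Type} (f : Q → W → Q × W) : Q → List W → List W → Q × List W
  | q, [], acc => (q, acc)
  | q, w :: l, acc => pass f (f q w).1 l ((f q w).2 :: acc)

/-- The finite data of a sweep machine.  It reads a word over `S` letter by letter and keeps a
list of cells in `W`, which initially consists of the cell `base` followed by cells made from a
certificate over `C`.  For each letter, it transforms the list of cells by a pass from left to
right with the transducer `fwd`, and then by a pass from right to left with `bwd`. -/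
structure Data (S C W Q : Type) where
  /-- The initial content of the cell given by a letter of the certificate. -/
  conv : C → W
  /-- The initial content of the leftmost cell. -/
  base : W
  /-- The initial control state. -/
  init : Q
  /-- Update of the control state when a letter is read. -/
  read : S → Q → Q
  /-- The transducer of the passes from left to right. -/
  fwd : Q → W → Q × W
  /-- Update of the control state between the two passes. -/
  turn : Q → Q
  /-- The transducer of the passes from right to left. -/
  bwd : Q → W → Q × W
  /-- The answer, depending on the last control state. -/
  answer : Q → Bool

variable {S C W Q : Type} (T : Data S C W Q)

/-- The effect of a letter on the control state and the list of cells. -/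
def Data.sweep (z : Q × List W) (s : S) : Q × List W :=
  let z' := pass T.fwd (T.read s z.1) z.2 []
  pass T.bwd (T.turn z'.1) z'.2 []

/-- The cells at the beginning.  The certificate is written from right to left, since it is
reversed when it is moved from the input stack to the stack of cells. -/
def Data.cells (y : List C) : List W := T.base :: (y.map T.conv).reverse

/-- The answer of the sweep machine on the word `z.1` with the certificate `z.2`. -/
def Data.verdict (z : List S × List C) : Bool :=
  T.answer (z.1.foldl T.sweep (T.init, T.cells z.2)).1

theorem length_pass (f : Q → W → Q × W) (q : Q) (l acc : List W) :
    (pass f q l acc).2.length = l.length + acc.length := by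
  induction l generalizing q acc with
  | nil => simp [pass]
  | cons w l ih => simp [pass, ih]; omega

theorem length_sweep (z : Q × List W) (s : S) : (T.sweep z s).2.length = z.2.length := by
  simp [Data.sweep, length_pass]

theorem length_foldl_sweep (z : Q × List W) (x : List S) :
    (x.foldl T.sweep z).2.length = z.2.length := by
  induction x generalizing z with
  | nil => rfl
  | cons s x ih => rw [List.foldl_cons, ih, length_sweep]

/-- The stacks: the input, the word reversed and in the right order, the cells to the right and
to the left of the current position, and the output. -/
inductive Stk
  | inp
  | xr
  | xs
  | ys
  | yr
  | out
  deriving DecidableEq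

instance : Fintype Stk where
  elems := {.inp, .xr, .xs, .ys, .yr, .out}
  complete k := by cases k <;> simp

/-- The labels of the program. -/
inductive Lab
  | load
  | rev
  | next
  | fwd
  | bwd
  | fin
  deriving DecidableEq

instance : Fintype Lab where
  elems := {.load, .rev, .next, .fwd, .bwd, .fin}
  complete k := by cases k <;> simp

/-- The alphabets of the stacks. -/
abbrev Alph (S C W : Type) : Stk → Type
  | .inp => S ⊕ C
  | .xr => S
  | .xs => S
  | .ys => W
  | .yr => W
  | .out => Bool

/-- The internal memory: the control state, and registers for a letter and for a cell. -/
abbrev Mem (S W Q : Type) : Type := Q × Option S × Option W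

open Turing.TM2.Stmt in
/-- The program of the machine. -/
def Data.prog [Inhabited S] : Lab → Turing.TM2.Stmt (Alph S C W) Lab (Mem S W Q)
  | .load =>
      pop .inp (fun v (o : Option (S ⊕ C)) => match o with
        | none => (v.1, none, none)
        | some (.inl s) => (v.1, some s, none)
        | some (.inr c) => (v.1, none, some (T.conv c))) <|
      branch (fun v => v.2.1.isSome)
        (push .xr (fun v => v.2.1.getD default) <| goto fun _ => .load) <|
      branch (fun v => v.2.2.isSome)
        (push .ys (fun v => v.2.2.getD T.base) <| goto fun _ => .load) <|
      push .ys (fun _ => T.base) <| goto fun _ => .rev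
  | .rev =>
      pop .xr (fun v (o : Option S) => (v.1, o, none)) <|
      branch (fun v => v.2.1.isSome)
        (push .xs (fun v => v.2.1.getD default) <| goto fun _ => .rev) <|
      goto fun _ => .next
  | .next =>
      pop .xs (fun v (o : Option S) => match o with
        | none => (v.1, none, none)
        | some s => (T.read s v.1, some s, none)) <|
      branch (fun v => v.2.1.isSome) (goto fun _ => .fwd) <|
      goto fun _ => .fin
  | .fwd =>
      pop .ys (fun v (o : Option W) => match o with
        | none => (T.turn v.1, none, none)
        | some w => ((T.fwd v.1 w).1, none, some (T.fwd v.1 w).2)) <|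
      branch (fun v => v.2.2.isSome)
        (push .yr (fun v => v.2.2.getD T.base) <| goto fun _ => .fwd) <|
      goto fun _ => .bwd
  | .bwd =>
      pop .yr (fun v (o : Option W) => match o with
        | none => (v.1, none, none)
        | some w => ((T.bwd v.1 w).1, none, some (T.bwd v.1 w).2)) <|
      branch (fun v => v.2.2.isSome)
        (push .ys (fun v => v.2.2.getD T.base) <| goto fun _ => .bwd) <|
      goto fun _ => .next
  | .fin =>
      pop .ys (fun v (o : Option W) => (v.1, none, o)) <|
      branch (fun v => v.2.2.isSome) (goto fun _ => .fin) <|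
      push .out (fun v => T.answer v.1) <| load (fun _ => (T.init, none, none)) halt

/-- The sweep machine as a Turing machine. -/
noncomputable def Data.machine [Inhabited S] [Finite S] [Finite C] [Finite W] [Finite Q] :
    Turing.FinTM2 :=
  letI : Fintype (Mem S W Q) := Fintype.ofFinite _
  letI : Fintype (S ⊕ C) := Fintype.ofFinite _
  { K := Stk, k₀ := .inp, k₁ := .out, Γ := Alph S C W, Λ := Lab, main := .load, σ := Mem S W Q,
    initialState := (T.init, none, none), Γk₀Fin := ‹Fintype (S ⊕ C)›, m := T.prog }

/-- The contents of the stacks, as a function of the stack. -/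
def tapes (i : List (S ⊕ C)) (xr xs : List S) (ys yr : List W) (o : List Bool) :
    (k : Stk) → List (Alph S C W k)
  | .inp => i
  | .xr => xr
  | .xs => xs
  | .ys => ys
  | .yr => yr
  | .out => o

section Stacks

variable (i i' : List (S ⊕ C)) (xr xs xr' : List S) (ys yr ys' : List W) (o o' : List Bool)

theorem update_inp : Function.update (tapes i xr xs ys yr o) .inp i' =
    tapes i' xr xs ys yr o := by
  funext k; cases k <;> rfl

theorem update_xr : Function.update (tapes i xr xs ys yr o) .xr xr' =
    tapes i xr' xs ys yr o := by
  funext k; cases k <;> rfl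

theorem update_xs : Function.update (tapes i xr xs ys yr o) .xs xr' =
    tapes i xr xr' ys yr o := by
  funext k; cases k <;> rfl

theorem update_ys : Function.update (tapes i xr xs ys yr o) .ys ys' =
    tapes i xr xs ys' yr o := by
  funext k; cases k <;> rfl

theorem update_yr : Function.update (tapes i xr xs ys yr o) .yr ys' =
    tapes i xr xs ys ys' o := by
  funext k; cases k <;> rfl

theorem update_out : Function.update (tapes i xr xs ys yr o) .out o' =
    tapes i xr xs ys yr o' := by
  funext k; cases k <;> rfl

end Stacks

/-- `n` steps of the program lead from the configuration `a` to the configuration `b`. -/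
def Data.Runs [Inhabited S] (n : ℕ) (a b : Turing.TM2.Cfg (Alph S C W) Lab (Mem S W Q)) : Prop :=
  (flip bind (Turing.TM2.step T.prog))^[n] (some a) = some b

section Runs

variable {T} [Inhabited S] {a b c : Turing.TM2.Cfg (Alph S C W) Lab (Mem S W Q)} {m n : ℕ}

theorem Data.Runs.trans (h₁ : T.Runs m a b) (h₂ : T.Runs n b c) : T.Runs (m + n) a c := by
  unfold Data.Runs at *
  rw [Nat.add_comm, Function.iterate_add_apply, h₁, h₂]

theorem Data.Runs.head (h₁ : Turing.TM2.step T.prog a = some b) (h₂ : T.Runs n b c) :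
    T.Runs (n + 1) a c := by
  unfold Data.Runs at *
  rw [Function.iterate_succ_apply]
  exact (congrArg _ h₁).trans h₂

theorem Data.Runs.single (h : Turing.TM2.step T.prog a = some b) : T.Runs 1 a b := h

end Runs

section Steps

variable [Inhabited S]

theorem runs_rev (q : Q) (r : Option S × Option W) (xr xs : List S) (ys : List W) :
    T.Runs (xr.length + 1) ⟨some .rev, (q, r), tapes [] xr xs ys [] []⟩
      ⟨some .next, (q, none, none), tapes [] [] (xr.reverse ++ xs) ys [] []⟩ := by
  induction xr generalizing xs r with
  | nil =>
    apply Data.Runs.single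
    simp [Data.prog, tapes, update_xr]
  | cons s xr ih =>
    have h := ih (some s, none) (s :: xs)
    rw [List.reverse_cons, List.append_assoc]
    refine Data.Runs.head ?_ h
    simp [Data.prog, tapes, update_xr, update_xs]

theorem runs_load_cells (r : Option S × Option W) (xr : List S) (y : List C) (ys : List W) :
    T.Runs (y.length + 1) ⟨some .load, (T.init, r), tapes (y.map .inr) xr [] ys [] []⟩
      ⟨some .rev, (T.init, none, none),
        tapes [] xr [] (T.base :: ((y.map T.conv).reverse ++ ys)) [] []⟩ := by
  induction y generalizing ys r with
  | nil =>
    apply Data.Runs.single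
    simp [Data.prog, tapes, update_inp, update_ys]
  | cons c y ih =>
    have h := ih (none, some (T.conv c)) (T.conv c :: ys)
    rw [List.map_cons, List.map_cons, List.reverse_cons, List.append_assoc]
    refine Data.Runs.head ?_ h
    simp [Data.prog, tapes, update_inp, update_ys]

theorem runs_load (r : Option S × Option W) (x xr : List S) (y : List C) :
    T.Runs (x.length + y.length + 1)
      ⟨some .load, (T.init, r), tapes (x.map .inl ++ y.map .inr) xr [] [] [] []⟩
      ⟨some .rev, (T.init, none, none), tapes [] (x.reverse ++ xr) [] (T.cells y) [] []⟩ := by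
  induction x generalizing xr r with
  | nil => simpa [Data.cells] using runs_load_cells T r xr y []
  | cons s x ih =>
    have h := ih (some s, none) (s :: xr)
    rw [List.map_cons, List.reverse_cons, List.append_assoc, List.length_cons,
      show x.length + 1 + y.length + 1 = x.length + y.length + 1 + 1 by omega]
    refine Data.Runs.head ?_ h
    simp [Data.prog, tapes, update_inp, update_xr]

theorem runs_fwd (q : Q) (r : Option S × Option W) (xs : List S) (ys yr : List W) :
    T.Runs (ys.length + 1) ⟨some .fwd, (q, r), tapes [] [] xs ys yr []⟩
      ⟨some .bwd, (T.turn (pass T.fwd q ys yr).1, none, none),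
        tapes [] [] xs [] (pass T.fwd q ys yr).2 []⟩ := by
  induction ys generalizing q yr r with
  | nil =>
    apply Data.Runs.single
    simp [Data.prog, tapes, update_ys, pass]
  | cons w ys ih =>
    have h := ih (T.fwd q w).1 (none, some (T.fwd q w).2) ((T.fwd q w).2 :: yr)
    refine Data.Runs.head ?_ h
    simp [Data.prog, tapes, update_ys, update_yr]

theorem runs_bwd (q : Q) (r : Option S × Option W) (xs : List S) (ys yr : List W) :
    T.Runs (yr.length + 1) ⟨some .bwd, (q, r), tapes [] [] xs ys yr []⟩
      ⟨some .next, ((pass T.bwd q yr ys).1, none, none),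
        tapes [] [] xs (pass T.bwd q yr ys).2 [] []⟩ := by
  induction yr generalizing q ys r with
  | nil =>
    apply Data.Runs.single
    simp [Data.prog, tapes, update_yr, pass]
  | cons w yr ih =>
    have h := ih (T.bwd q w).1 (none, some (T.bwd q w).2) ((T.bwd q w).2 :: ys)
    refine Data.Runs.head ?_ h
    simp [Data.prog, tapes, update_ys, update_yr]

theorem runs_sweeps (z : Q × List W) (xs : List S) :
    T.Runs (xs.length * (2 * z.2.length + 3) + 1)
      ⟨some .next, (z.1, none, none), tapes [] [] xs z.2 [] []⟩
      ⟨some .fin, ((xs.foldl T.sweep z).1, none, none),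
        tapes [] [] [] (xs.foldl T.sweep z).2 [] []⟩ := by
  induction xs generalizing z with
  | nil =>
    simp only [List.length_nil, Nat.zero_mul, Nat.zero_add]
    apply Data.Runs.single
    simp [Data.prog, tapes, update_xs]
  | cons s xs ih =>
    have h₁ := runs_fwd T (T.read s z.1) (some s, none) xs z.2 []
    have h₂ := runs_bwd T (T.turn (pass T.fwd (T.read s z.1) z.2 []).1) (none, none) xs []
      (pass T.fwd (T.read s z.1) z.2 []).2
    have h₃ := ih (T.sweep z s)
    have h := (h₁.trans h₂).trans h₃
    rw [length_sweep, length_pass] at h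
    rw [List.length_cons, List.foldl_cons, show (xs.length + 1) * (2 * z.2.length + 3) + 1 =
      z.2.length + 1 + (z.2.length + ([] : List W).length + 1) +
        (xs.length * (2 * z.2.length + 3) + 1) + 1 by rw [List.length_nil]; ring]
    refine Data.Runs.head ?_ h
    simp [Data.prog, tapes, update_xs]

theorem runs_fin (q : Q) (r : Option S × Option W) (ys : List W) :
    T.Runs (ys.length + 1) ⟨some .fin, (q, r), tapes [] [] [] ys [] []⟩
      ⟨none, (T.init, none, none), tapes [] [] [] [] [] [T.answer q]⟩ := by
  induction ys generalizing r with
  | nil =>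
    apply Data.Runs.single
    simp [Data.prog, tapes, update_ys, update_out]
  | cons w ys ih =>
    refine Data.Runs.head ?_ (ih (none, some w))
    simp [Data.prog, tapes, update_ys]

theorem runs_verdict (z : List S × List C) :
    T.Runs (z.1.length * (2 * z.2.length + 7) + 2 * z.2.length + 5)
      ⟨some .load, (T.init, none, none), tapes (Complexity.encodePair z) [] [] [] [] []⟩
      ⟨none, (T.init, none, none), tapes [] [] [] [] [] [T.verdict z]⟩ := by
  obtain ⟨x, y⟩ := z
  have h₁ := runs_load T (none, none) x [] y
  have h₂ := runs_rev T T.init (none, none) (x.reverse ++ []) [] (T.cells y)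
  have h₃ := runs_sweeps T (T.init, T.cells y) x
  have h₄ := runs_fin T (x.foldl T.sweep (T.init, T.cells y)).1 (none, none)
    (x.foldl T.sweep (T.init, T.cells y)).2
  simp only [List.append_nil, List.reverse_reverse] at h₁ h₂
  have h := ((h₁.trans h₂).trans h₃).trans h₄
  rw [length_foldl_sweep] at h
  simp only [Data.cells, List.length_cons, List.length_reverse, List.length_map] at h
  have e : x.length * (2 * y.length + 7) + 2 * y.length + 5 =
      x.length + y.length + 1 + (x.length + 1) + (x.length * (2 * (y.length + 1) + 3) + 1) +
        (y.length + 1 + 1) := by ring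
  rw [e]
  exact h

end Steps

/-- The answers of a sweep machine with finite data are computed in polynomial time. -/
theorem Data.polyTime [Inhabited S] [Finite S] [Finite C] [Finite W] [Finite Q] :
    Nonempty (Turing.TM2ComputableInPolyTime Complexity.encodePair Computability.encodeBool
      T.verdict) := by
  refine ⟨{ tm := T.machine, inputAlphabet := Equiv.refl (S ⊕ C),
            outputAlphabet := Equiv.refl Bool,
            time := 2 * Polynomial.X ^ 2 + 8 * Polynomial.X + 5, outputsFun := fun z => ?_ }⟩
  refine ⟨⟨z.1.length * (2 * z.2.length + 7) + 2 * z.2.length + 5, ?_⟩, ?_⟩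
  · have h := runs_verdict T z
    have e₁ : Turing.initList T.machine (List.map (Equiv.refl (S ⊕ C)).invFun
        (Complexity.encodePair z)) = (⟨some .load, (T.init, none, none),
        tapes (Complexity.encodePair z) [] [] [] [] []⟩ :
          Turing.TM2.Cfg (Alph S C W) Lab (Mem S W Q)) := by
      unfold Turing.initList
      congr 1
      funext k
      cases k
      · exact List.map_id _
      all_goals rfl
    have e₂ : Turing.haltList T.machine (List.map (Equiv.refl Bool).invFun
        (Computability.encodeBool (T.verdict z))) = (⟨none, (T.init, none, none),
        tapes [] [] [] [] [] [T.verdict z]⟩ :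
          Turing.TM2.Cfg (Alph S C W) Lab (Mem S W Q)) := by
      unfold Turing.haltList
      congr 1
      funext k
      cases k <;> rfl
    rw [Option.map_some]
    erw [e₁, e₂]
    exact h
  · simp only [Complexity.encodePair, List.length_append, List.length_map, Polynomial.eval_add,
      Polynomial.eval_mul, Polynomial.eval_pow, Polynomial.eval_X, Polynomial.eval_ofNat]
    nlinarith [Nat.zero_le (z.1.length * z.2.length), Nat.zero_le (z.1.length ^ 2),
      Nat.zero_le (z.2.length ^ 2)]

end SweepMachine

namespace Keyboards

variable {A : Type}

/-! ### The action of keys on words -/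

/-- The action of an operation on a word, the cursor being at its end.  The arrows, which do not
occur in `BK` keyboards, are given no effect. -/
def Op.write : Op A → List A → List A
  | .letter a, u => u ++ [a]
  | .backspace, u => u.dropLast
  | .left, u => u
  | .right, u => u

/-- The action of a sequence of operations on a word, the cursor being at its end. -/
def writeAll (t : Key A) (u : List A) : List A := t.foldl (fun u σ => σ.write u) u

@[simp] theorem writeAll_nil (u : List A) : writeAll [] u = u := rfl

theorem writeAll_append (s t : Key A) (u : List A) :
    writeAll (s ++ t) u = writeAll t (writeAll s u) := by
  simp [writeAll]

theorem writeAll_concat (t : Key A) (σ : Op A) (u : List A) :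
    writeAll (t ++ [σ]) u = σ.write (writeAll t u) := by
  simp [writeAll]

theorem key_act_eq_writeAll {t : Key A} (ht : Op.left ∉ t ∧ Op.right ∉ t) (u : List A) :
    Key.act t (u, []) = (writeAll t u, []) := by
  induction t generalizing u with
  | nil => rfl
  | cons σ t ih =>
    simp only [List.mem_cons, not_or] at ht
    have h : ∀ u', Key.act t (u', []) = (writeAll t u', []) := ih ⟨ht.1.2, ht.2.2⟩
    cases σ with
    | letter a => exact h _
    | backspace => exact h _
    | left => exact absurd rfl ht.1.1
    | right => exact absurd rfl ht.2.1

theorem actSeq_eq_writeAll {τ : List (Key A)} (hτ : ∀ t ∈ τ, Op.left ∉ t ∧ Op.right ∉ t)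
    (u : List A) : actSeq τ (u, []) = (writeAll τ.flatten u, []) := by
  induction τ generalizing u with
  | nil => rfl
  | cons t τ ih =>
    have h : actSeq (t :: τ) (u, []) = actSeq τ (Key.act t (u, [])) := rfl
    rw [h, key_act_eq_writeAll (hτ t (by simp)), ih fun s hs => hτ s (by simp [hs]),
      List.flatten_cons, writeAll_append]

theorem AutomaticKeyboard.IsBK.mem_language_iff {K : AutomaticKeyboard A} (hK : K.IsBK)
    {w : List A} : w ∈ K.language ↔
      ∃ τ : List (Key A), τ ≠ [] ∧ (∀ t ∈ τ, t ∈ K) ∧ writeAll τ.flatten [] = w := by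
  constructor
  · rintro ⟨τ, h₀, h₁, u, v, h, rfl⟩
    rw [actSeq_eq_writeAll fun t ht => hK t (h₁ t ht), Prod.mk.injEq] at h
    exact ⟨τ, h₀, h₁, by rw [h.1, ← h.2, List.append_nil]⟩
  · rintro ⟨τ, h₀, h₁, rfl⟩
    exact ⟨τ, h₀, h₁, _, [], actSeq_eq_writeAll (fun t ht => hK t (h₁ t ht)) _, by simp⟩

/-- Since a letter followed by a backspace has no effect, every sequence of operations amounts to
some number of backspaces followed by some word, also on contents which are too short for the
backspaces. -/
theorem exists_writeAll_eq (t : Key A) : ∃ (n : ℕ) (v : List A), n + v.length ≤ t.length ∧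
    ∀ u, writeAll t u = u.take (u.length - n) ++ v := by
  induction t using List.reverseRecOn with
  | nil => exact ⟨0, [], by simp, by simp⟩
  | append_singleton t σ ih =>
    obtain ⟨n, v, hn, h⟩ := ih
    simp only [writeAll_concat, h, List.length_append, List.length_singleton]
    cases σ with
    | letter a =>
      exact ⟨n, v ++ [a], by simp; omega, fun u => by simp [Op.write]⟩
    | backspace =>
      rcases List.eq_nil_or_concat v with rfl | ⟨v, b, rfl⟩
      · refine ⟨n + 1, [], by simpa using hn, fun u => ?_⟩
        simp only [Op.write, List.append_nil, List.dropLast_eq_take, List.length_take,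
          List.take_take]
        congr 1
        omega
      · refine ⟨n, v, by simp at hn; omega, fun u => ?_⟩
        rw [List.concat_eq_append, Op.write, ← List.append_assoc, List.dropLast_concat]
    | left => exact ⟨n, v, by omega, fun u => rfl⟩
    | right => exact ⟨n, v, by omega, fun u => rfl⟩

/-! ### Short words decide universality -/

/-- After the last key that replaces the whole content (by a word `v`), the run `ρ` never uses a
backspace on the empty word, hence it can be repeated on top of any word `y`. -/
theorem exists_liftable_run {M : ℕ} (τ : List (Key A)) (hM : ∀ t ∈ τ, t.length ≤ M) :
    ∃ (v : List A) (ρ : List (Key A)), v.length ≤ M ∧ (∀ t ∈ ρ, t ∈ τ) ∧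
      ∀ y, writeAll ρ.flatten (y ++ v) = y ++ writeAll τ.flatten [] := by
  induction τ using List.reverseRecOn with
  | nil => exact ⟨[], [], by simp, by simp, by simp⟩
  | append_singleton τ t ih =>
    obtain ⟨v, ρ, hv, hρ, h⟩ := ih fun s hs => hM s (by simp [hs])
    obtain ⟨n, v', hn, ht⟩ := exists_writeAll_eq t
    have htM : t.length ≤ M := hM t (by simp)
    have e : writeAll (τ ++ [t]).flatten [] = writeAll t (writeAll τ.flatten []) := by
      rw [List.flatten_append, writeAll_append]; simp
    by_cases hlen : (writeAll τ.flatten []).length ≤ n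
    · refine ⟨v', [], by omega, by simp, fun y => ?_⟩
      rw [e, ht, Nat.sub_eq_zero_of_le hlen]
      simp
    · refine ⟨v, ρ ++ [t], hv, ?_, fun y => ?_⟩
      · intro s hs
        rw [List.mem_append] at hs ⊢
        exact hs.imp_left (hρ s)
      · rw [List.flatten_append, writeAll_append, h, e]
        simp only [List.flatten_cons, List.flatten_nil, List.append_nil, ht, List.length_append]
        rw [Nat.add_sub_assoc (by omega), List.take_length_add_append, List.append_assoc]

/-- A keyboard of class `BK` is universal as soon as it recognizes the words of length at most
`‖K‖∞ + 1`. -/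
theorem AutomaticKeyboard.IsBK.universal_of_short {K : AutomaticKeyboard A} (hK : K.IsBK)
    (h : ∀ w : List A, w.length ≤ K.normInf + 1 → w ∈ K.language) : K.Universal := by
  intro w
  induction hw : w.length using Nat.strong_induction_on generalizing w with
  | _ n ih =>
    by_cases hn : n ≤ K.normInf + 1
    · exact h w (hw ▸ hn)
    · -- `y ++ u` with `u` of length `‖K‖∞ + 1` is obtained from a shorter word `y ++ v`.
      obtain ⟨y, u, rfl, hu⟩ : ∃ y u, w = y ++ u ∧ u.length = K.normInf + 1 :=
        ⟨_, _, (List.take_append_drop (n - (K.normInf + 1)) w).symm, by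
          rw [List.length_drop]; omega⟩
      obtain ⟨τ, -, hτ, rfl⟩ := hK.mem_language_iff.1 (h u hu.le)
      obtain ⟨v, ρ, hv, hρ, hr⟩ := exists_liftable_run (M := K.normInf) τ
        fun t ht => Finset.le_sup (f := List.length) (hτ t ht)
      rw [List.length_append] at hw
      obtain ⟨τ', h₀, hτ', e⟩ := hK.mem_language_iff.1
        (ih (y ++ v).length (by rw [List.length_append]; omega) (y ++ v) rfl)
      refine hK.mem_language_iff.2 ⟨τ' ++ ρ, by simp [h₀], ?_, ?_⟩
      · intro t ht
        rcases List.mem_append.1 ht with ht | ht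
        exacts [hτ' t ht, hτ t (hρ t ht)]
      · rw [List.flatten_append, writeAll_append, e, hr]

/-! ### Positions relative to a word -/

open Classical in
/-- The effect of an operation on the position of the content `u` relative to a word `w`.  The
position is `(i, h)` if `u` agrees with `w` on exactly the first `i` letters and has `h` further
letters. -/
noncomputable def track (w : List A) : Op A → ℕ × ℕ → ℕ × ℕ
  | .letter a, (i, 0) => if w[i]? = some a then (i + 1, 0) else (i, 1)
  | .letter _, (i, h + 1) => (i, h + 2)
  | .backspace, (i, 0) => (i - 1, 0)
  | .backspace, (i, h + 1) => (i, h)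
  | .left, q => q
  | .right, q => q

/-- The effect of a sequence of operations on the position relative to `w`. -/
noncomputable def trackAll (w : List A) (t : Key A) (q : ℕ × ℕ) : ℕ × ℕ :=
  t.foldl (fun q σ => track w σ q) q

theorem trackAll_append (w : List A) (s t : Key A) (q : ℕ × ℕ) :
    trackAll w (s ++ t) q = trackAll w t (trackAll w s q) := by
  simp [trackAll]

/-- `q` is the position of `u` relative to `w`. -/
def IsPos (w u : List A) (q : ℕ × ℕ) : Prop :=
  q.1 ≤ w.length ∧ ∃ z, u = w.take q.1 ++ z ∧ z.length = q.2 ∧ ∀ a ∈ z.head?, w[q.1]? ≠ some a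

theorem isPos_nil (w : List A) : IsPos w [] (0, 0) := ⟨by simp, [], by simp⟩

theorem dropLast_take {w : List A} {i : ℕ} (hi : i ≤ w.length) :
    (w.take i).dropLast = w.take (i - 1) := by
  rw [List.dropLast_eq_take, List.take_take, List.length_take]
  congr 1
  omega

theorem IsPos.write {w u : List A} {q : ℕ × ℕ} (h : IsPos w u q) (σ : Op A) :
    IsPos w (σ.write u) (track w σ q) := by
  obtain ⟨i, k⟩ := q
  obtain ⟨hi, z, rfl, hz, hd⟩ := h
  dsimp only at hi hz hd
  cases σ with
  | left => exact ⟨hi, z, rfl, hz, hd⟩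
  | right => exact ⟨hi, z, rfl, hz, hd⟩
  | letter a =>
    cases k with
    | zero =>
      obtain rfl := List.length_eq_zero_iff.1 hz
      by_cases ha : w[i]? = some a
      · simp only [track, ha, if_true, Op.write]
        obtain ⟨hlt, rfl⟩ := List.getElem?_eq_some_iff.1 ha
        exact ⟨hlt, [], by simp, rfl, by simp⟩
      · simp only [track, ha, if_false, Op.write]
        exact ⟨hi, [a], by simp, rfl, by simpa using ha⟩
    | succ k =>
      change IsPos w _ (i, k + 2)
      refine ⟨hi, z ++ [a], by simp [Op.write], by simp [hz], ?_⟩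
      cases z with
      | nil => simp at hz
      | cons b z => exact hd
  | backspace =>
    cases k with
    | zero =>
      obtain rfl := List.length_eq_zero_iff.1 hz
      change IsPos w _ (i - 1, 0)
      refine ⟨(Nat.sub_le i 1).trans hi, [], ?_, rfl, by simp⟩
      simp [Op.write, dropLast_take hi]
    | succ k =>
      change IsPos w _ (i, k)
      have hne : z ≠ [] := by rintro rfl; simp at hz
      refine ⟨hi, z.dropLast, ?_, by simp [hz], ?_⟩
      · simp only [Op.write]
        rw [List.dropLast_append_of_ne_nil hne]
      · match z, hd with
        | [], _ => simp
        | [b], _ => simp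
        | b :: c :: z, hd => simpa using hd

theorem IsPos.writeAll {w u : List A} {q : ℕ × ℕ} (h : IsPos w u q) (t : Key A) :
    IsPos w (writeAll t u) (trackAll w t q) := by
  induction t generalizing u q with
  | nil => exact h
  | cons σ t ih => exact ih (h.write σ)

theorem IsPos.eq_of_self {w : List A} {q : ℕ × ℕ} (h : IsPos w w q) : q = (w.length, 0) := by
  obtain ⟨i, k⟩ := q
  obtain ⟨hi, z, e, hz, hd⟩ := h
  dsimp only at hi hz e hd
  have hzd : z = w.drop i := by
    conv at e => lhs; rw [← List.take_append_drop i w]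
    exact (List.append_cancel_left e).symm
  subst hzd
  have : w.length ≤ i := by
    by_contra hlt
    push Not at hlt
    refine hd (w[i]) ?_ (by simp [hlt])
    simp [List.head?_drop, hlt]
  obtain rfl := le_antisymm hi this
  rw [← hz]
  simp

/-! ### Bounding the height -/

/-- The growth of the content caused by an operation, if the content is not empty. -/
def Op.weight : Op A → ℤ
  | .letter _ => 1
  | .backspace => -1
  | .left => 0
  | .right => 0

/-- The growth of the content caused by a key, if the content is long. -/
def weight (t : Key A) : ℤ := (t.map Op.weight).sum

theorem abs_weight_le (t : Key A) : |weight t| ≤ t.length := by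
  induction t with
  | nil => simp [weight]
  | cons σ t ih =>
    have h : weight (σ :: t) = σ.weight + weight t := by simp [weight]
    have h' : |σ.weight| ≤ 1 := by cases σ <;> simp [Op.weight]
    rw [h, List.length_cons]
    push_cast
    linarith [abs_add_le σ.weight (weight t)]

theorem track_snd_le (w : List A) (σ : Op A) (q : ℕ × ℕ) : (track w σ q).2 ≤ q.2 + 1 := by
  obtain ⟨i, _ | k⟩ := q <;> cases σ <;> simp only [track] <;> (try split_ifs) <;>
    omega

theorem trackAll_snd_le (w : List A) (t : Key A) (q : ℕ × ℕ) :
    (trackAll w t q).2 ≤ q.2 + t.length := by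
  induction t generalizing q with
  | nil => simp [trackAll]
  | cons σ t ih =>
    have h := ih (track w σ q)
    have h' := track_snd_le w σ q
    rw [List.length_cons]
    exact h.trans (by omega)

theorem trackAll_of_length_le (w : List A) (t : Key A) (q : ℕ × ℕ) (h : t.length ≤ q.2) :
    (trackAll w t q).1 = q.1 ∧ ((trackAll w t q).2 : ℤ) = q.2 + weight t := by
  induction t generalizing q with
  | nil => simp [trackAll, weight]
  | cons σ t ih =>
    obtain ⟨i, _ | k⟩ := q
    · simp at h
    have e : track w σ (i, k + 1) = (i, (track w σ (i, k + 1)).2) ∧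
        ((track w σ (i, k + 1)).2 : ℤ) = (k + 1 : ℕ) + σ.weight := by
      cases σ <;> simp [track, Op.weight]; ring
    have hk : t.length ≤ (track w σ (i, k + 1)).2 := by
      have : -1 ≤ σ.weight := by cases σ <;> simp [Op.weight]
      rw [List.length_cons] at h
      have := e.2
      push_cast at *
      omega
    obtain ⟨h₁, h₂⟩ := ih _ hk
    refine ⟨h₁.trans (by rw [e.1]), h₂.trans ?_⟩
    rw [e.2, weight, weight, List.map_cons, List.sum_cons]
    ring

/-- The positions relative to `w` reached by at least one key from `K`, where each key is applied
at a height of at most `B`. -/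
inductive LowReach (K : AutomaticKeyboard A) (w : List A) (B : ℕ) : ℕ × ℕ → Prop
  | first (t : Key A) (ht : t ∈ K) : LowReach K w B (trackAll w t (0, 0))
  | step (t : Key A) (ht : t ∈ K) (q : ℕ × ℕ) (hq : q.2 ≤ B) (h : LowReach K w B q) :
      LowReach K w B (trackAll w t q)

/-- At heights of at least `M`, every key just adds its weight.  A sequence of keys can therefore
be reordered so that growing keys are applied below height `2 * M` and shrinking keys above. -/
theorem LowReach.reorder {K : AutomaticKeyboard A} {w : List A} {M : ℕ}
    (hM : ∀ t ∈ K, t.length ≤ M) (i b : ℕ) (hb : M ≤ b) (hb' : b ≤ 2 * M) :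
    ∀ (n : ℕ) (s : List (Key A)) (a : ℕ), s.length = n → (∀ t ∈ s, t ∈ K) →
      LowReach K w (3 * M) (i, a) → M ≤ a → a ≤ 3 * M →
      (b : ℤ) = a + (s.map weight).sum → LowReach K w (3 * M) (i, b) := by
  have key : ∀ (t : Key A) (a : ℕ), t ∈ K → LowReach K w (3 * M) (i, a) → M ≤ a → a ≤ 3 * M →
      ∃ a' : ℕ, (a' : ℤ) = a + weight t ∧ LowReach K w (3 * M) (i, a') := by
    intro t a ht ha h₁ h₂
    obtain ⟨e₁, e₂⟩ := trackAll_of_length_le w t (i, a) ((hM t ht).trans h₁)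
    refine ⟨_, e₂, ?_⟩
    have := LowReach.step t ht (i, a) h₂ ha
    rwa [← show (i, (trackAll w t (i, a)).2) = trackAll w t (i, a) from
      Prod.ext e₁.symm rfl] at this
  intro n
  induction n with
  | zero =>
    intro s a hs _ ha _ _ e
    obtain rfl := List.length_eq_zero_iff.1 hs
    simp only [List.map_nil, List.sum_nil, add_zero, Nat.cast_inj] at e
    rwa [e]
  | succ n ih =>
    intro s a hs hsK ha h₁ h₂ e
    -- It suffices to find the key which is applied next.
    suffices h : ∃ t ∈ s, (M : ℤ) ≤ a + weight t ∧ a + weight t ≤ 3 * M by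
      obtain ⟨t, hts, h₃, h₄⟩ := h
      obtain ⟨a', e', ha'⟩ := key t a (hsK t hts) ha h₁ h₂
      obtain ⟨s₁, s₂, rfl⟩ := List.append_of_mem hts
      refine ih (s₁ ++ s₂) a' ?_ (fun r hr => hsK r ?_) ha' (by omega) (by omega) ?_
      · simp at hs ⊢; omega
      · rw [List.mem_append] at hr
        simp only [List.mem_append, List.mem_cons]
        tauto
      · simp only [List.map_append, List.map_cons, List.sum_append, List.sum_cons] at e ⊢
        omega
    have hw : ∀ t ∈ s, |weight t| ≤ M := fun t ht =>
      (abs_weight_le t).trans (by exact_mod_cast hM t (hsK t ht))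
    by_cases hneg : ∃ t ∈ s, weight t < 0
    · by_cases h : 2 * M < a
      · obtain ⟨t, hts, ht⟩ := hneg
        have := abs_le.1 (hw t hts)
        exact ⟨t, hts, by omega, by omega⟩
      · by_cases hpos : ∃ t ∈ s, 0 ≤ weight t
        · obtain ⟨t, hts, ht⟩ := hpos
          have := abs_le.1 (hw t hts)
          exact ⟨t, hts, by omega, by omega⟩
        · push Not at hpos
          obtain ⟨t, hts, ht⟩ := hneg
          refine ⟨t, hts, ?_, by omega⟩
          obtain ⟨s₁, s₂, rfl⟩ := List.append_of_mem hts
          have hle : ∀ l : List (Key A), (∀ r ∈ l, weight r < 0) → (l.map weight).sum ≤ 0 :=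
            fun l hl => by
              simpa using List.sum_le_card_nsmul (l.map weight) 0
                (by simpa using fun r hr => (hl r hr).le)
          have l₁ := hle s₁ fun r hr => hpos r (by simp [hr])
          have l₂ := hle s₂ fun r hr => hpos r (by simp [hr])
          simp only [List.map_append, List.map_cons, List.sum_append, List.sum_cons] at e
          omega
    · push Not at hneg
      match s, hs with
      | t :: s, _ =>
        have ht := hneg t (by simp)
        have hs0 : 0 ≤ (s.map weight).sum :=
          List.sum_nonneg (by simpa using fun r hr => hneg r (by simp [hr]))
        simp only [List.map_cons, List.sum_cons] at e
        exact ⟨t, by simp, by omega, by omega⟩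

/-- Every position of height at most `2 * M` which can be reached at all can be reached by
applying keys at heights of at most `3 * M` only. -/
theorem lowReach_of_trackAll {K : AutomaticKeyboard A} {w : List A} {M : ℕ}
    (hM : ∀ t ∈ K, t.length ≤ M) {τ : List (Key A)} (h₀ : τ ≠ []) (hτ : ∀ t ∈ τ, t ∈ K)
    (h : (trackAll w τ.flatten (0, 0)).2 ≤ 2 * M) :
    LowReach K w (3 * M) (trackAll w τ.flatten (0, 0)) := by
  obtain ⟨t, τ, rfl⟩ := List.exists_cons_of_ne_nil h₀
  -- Above height `2 * M`, the run is on an excursion which started between `M` and `2 * M`.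
  suffices H : LowReach K w (3 * M) (trackAll w (t :: τ).flatten (0, 0)) ∧
      (trackAll w (t :: τ).flatten (0, 0)).2 ≤ 2 * M ∨
      2 * M < (trackAll w (t :: τ).flatten (0, 0)).2 ∧ ∃ (a : ℕ) (s : List (Key A)),
        (∀ r ∈ s, r ∈ K) ∧ LowReach K w (3 * M) ((trackAll w (t :: τ).flatten (0, 0)).1, a) ∧
        M ≤ a ∧ a ≤ 2 * M ∧
        ((trackAll w (t :: τ).flatten (0, 0)).2 : ℤ) = a + (s.map weight).sum by
    rcases H with H | H
    · exact H.1
    · omega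
  clear h h₀
  induction τ using List.reverseRecOn with
  | nil =>
    have ht := hτ t (by simp)
    have h₁ := trackAll_snd_le w t (0, 0)
    have h₂ := hM t ht
    left
    simp only [List.flatten_cons, List.flatten_nil, List.append_nil]
    exact ⟨.first t ht, by omega⟩
  | append_singleton τ r ih =>
    have hr := hτ r (by simp)
    replace ih := ih fun t' ht' => hτ t' (by simp at ht' ⊢; tauto)
    have e : trackAll w (t :: (τ ++ [r])).flatten (0, 0) =
        trackAll w r (trackAll w (t :: τ).flatten (0, 0)) := by
      rw [← trackAll_append]; simp
    rw [e]
    generalize trackAll w (t :: τ).flatten (0, 0) = q at ih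
    obtain ⟨i, k⟩ := q
    have h₁ := trackAll_snd_le w r (i, k)
    have h₂ := hM r hr
    have h₃ := abs_le.1 (abs_weight_le r)
    dsimp only at ih h₁
    rcases ih with ⟨hq, hk⟩ | ⟨hk, a, s, hs, ha, ha₁, ha₂, es⟩
    · by_cases hk' : (trackAll w r (i, k)).2 ≤ 2 * M
      · exact .inl ⟨.step r hr (i, k) (by dsimp only; omega) hq, hk'⟩
      · obtain ⟨e₁, e₂⟩ := trackAll_of_length_le w r (i, k) (by dsimp only; omega)
        refine .inr ⟨by omega, k, [r], by simpa using hr, ?_, by omega, hk, by simpa using e₂⟩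
        rw [e₁]
        exact hq
    · obtain ⟨e₁, e₂⟩ := trackAll_of_length_le w r (i, k) (by dsimp only; omega)
      dsimp only at e₁ e₂
      have hs' : ∀ t' ∈ s ++ [r], t' ∈ K := fun t' ht' => by
        rcases List.mem_append.1 ht' with h | h
        · exact hs t' h
        · rw [List.mem_singleton.1 h]; exact hr
      have es' : ((trackAll w r (i, k)).2 : ℤ) = a + ((s ++ [r]).map weight).sum := by
        rw [e₂, es]
        simp
        ring
      by_cases hk' : (trackAll w r (i, k)).2 ≤ 2 * M
      · refine .inl ⟨?_, hk'⟩
        rw [show trackAll w r (i, k) = (i, (trackAll w r (i, k)).2) from Prod.ext e₁ rfl]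
        exact LowReach.reorder hM i _ (by omega) hk' _ _ a rfl hs' ha ha₁ (by omega) es'
      · exact .inr ⟨by omega, a, _, hs', by rwa [e₁], ha₁, ha₂, es'⟩

end Keyboards

/-! ### Passes over indexed lists of cells -/

namespace SweepMachine

/-- The transducer `f` with a flag in its control state which is cleared when a check fails. -/
def withCheck {P W : Type} (f : P → W → P × W) (chk : P → W → Bool) (q : P × Bool) (x : W) :
    (P × Bool) × W :=
  (((f q.1 x).1, q.2 && chk q.1 x), (f q.1 x).2)

theorem pass_append {Q W : Type} (f : Q → W → Q × W) (q : Q) (l l' acc : List W) :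
    pass f q (l ++ l') acc = pass f (pass f q l acc).1 l' (pass f q l acc).2 := by
  induction l generalizing q acc with
  | nil => rfl
  | cons x l ih => exact ih _ _

section Indexed

variable {P W : Type} {f : P → W → P × W} {chk : P → W → Bool} {st : ℕ → P} {N : ℕ}

/-- A pass from left to right, described by the control state `st j` in front of cell `j`. -/
theorem pass_map_range {g g' : ℕ → W} (h : ∀ j < N, f (st j) (g j) = (st (j + 1), g' j)) (b : Bool)
    (acc : List W) : pass (withCheck f chk) (st 0, b) ((List.range N).map g) acc =
      ((st N, b && (List.range N).all fun j => chk (st j) (g j)),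
        ((List.range N).map g').reverse ++ acc) := by
  induction N with
  | zero => simp [pass]
  | succ N ih =>
    rw [List.range_succ, List.map_append, pass_append, ih fun j hj => h j (by omega)]
    simp [pass, withCheck, h N (by omega), Bool.and_assoc]

/-- A pass from right to left, described by the control state `st j` when the cells from `j` on
have been treated. -/
theorem pass_reverse_map_range {g g' : ℕ → W} (h : ∀ j < N, f (st (j + 1)) (g j) = (st j, g' j))
    (b : Bool) (acc : List W) :
    pass (withCheck f chk) (st N, b) ((List.range N).map g).reverse acc =
      ((st 0, b && (List.range N).all fun j => chk (st (j + 1)) (g j)),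
        (List.range N).map g' ++ acc) := by
  induction N generalizing b acc with
  | zero => simp [pass]
  | succ N ih =>
    rw [List.range_succ, List.map_append, List.reverse_append, pass_append]
    simp only [List.map_cons, List.map_nil, List.reverse_singleton, pass, withCheck, h N (by omega)]
    rw [ih fun j hj => h j (by omega)]
    simp [Bool.and_assoc, Bool.and_comm]

theorem pass_flatMap_range {F : P × Bool → W → (P × Bool) × W} {R R' : ℕ → List W} {e : ℕ → Bool}
    (h : ∀ i < N, ∀ b acc, pass F (st i, b) (R i) acc =
      ((st (i + 1), b && e i), (R' i).reverse ++ acc)) (b : Bool) (acc : List W) :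
    pass F (st 0, b) ((List.range N).flatMap R) acc =
      ((st N, b && (List.range N).all e), ((List.range N).flatMap R').reverse ++ acc) := by
  induction N with
  | zero => simp [pass]
  | succ N ih =>
    rw [List.range_succ, List.flatMap_append, pass_append, ih fun j hj => h j (by omega)]
    simp [h N (by omega), Bool.and_assoc]

theorem pass_reverse_flatMap_range {F : P × Bool → W → (P × Bool) × W} {R R' : ℕ → List W}
    {e : ℕ → Bool} (h : ∀ i < N, ∀ b acc, pass F (st (i + 1), b) (R i).reverse acc =
      ((st i, b && e i), R' i ++ acc)) (b : Bool) (acc : List W) :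
    pass F (st N, b) ((List.range N).flatMap R).reverse acc =
      ((st 0, b && (List.range N).all e), (List.range N).flatMap R' ++ acc) := by
  induction N generalizing b acc with
  | zero => simp [pass]
  | succ N ih =>
    rw [List.range_succ, List.flatMap_append, List.reverse_append, pass_append]
    simp only [List.flatMap_cons, List.flatMap_nil, List.append_nil, h N (by omega)]
    rw [ih fun j hj => h j (by omega)]
    simp [Bool.and_assoc, Bool.and_comm]

end Indexed

end SweepMachine

namespace Keyboards

/-! ### The verifier -/

/-- The kinds of cells: the cell of the position `(0, 0)`, the cells of the positions `(i + 1, 0)`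
with the letter of index `i` of the word, and the cells of the positions `(i, h + 1)`. -/
inductive Tag (A : Type) : Type
  | origin
  | head (a : A)
  | body

/-- A cell of the verifier, which stands for a position. -/
structure Cell (A : Type) where
  /-- The kind of the position. -/
  tag : Tag A
  /-- Whether the certificate claims that the position is reachable between two keys. -/
  safe : Bool
  /-- Whether the position is reachable from a safe one by the part of a key read so far. -/
  mark : Bool
  /-- Whether the cell has been used for measuring the length of its row. -/
  used : Bool

/-- The control state of the verifier, apart from the flag that tells whether all checks have
succeeded. -/
structure Ctl (A : Type) where
  /-- The symbol that has been read last; `none` at the beginning, as after a key. -/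
  sym : Option (Op A)
  /-- Whether an arrow has been read. -/
  arrow : Bool
  /-- The mark of the last cell with height `0` in this pass. -/
  hd : Bool
  /-- The mark of the last cell of this row in this pass. -/
  prev : Bool
  /-- The number of cells of this row which have been newly used in this pass. -/
  count : Fin 5

instance (A : Type) [Finite A] : Finite (Op A) :=
  Finite.of_injective (β := Option (Option (Option (Option A))))
    (fun | .letter a => some (some (some (some a))) | .backspace => some (some (some none))
         | .left => some (some none) | .right => some none)
    (by rintro (_ | _ | _ | _) (_ | _ | _ | _) h <;> simp_all)

instance (A : Type) [Finite A] : Finite (Tag A) :=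
  Finite.of_injective (β := Option (Option A))
    (fun | .head a => some (some a) | .body => some none | .origin => none)
    (by rintro (_ | _ | _) (_ | _ | _) h <;> simp_all)

instance (A : Type) [Finite A] : Finite (Cell A) :=
  Finite.of_injective (β := Tag A × Bool × Bool × Bool)
    (fun x => (x.tag, x.safe, x.mark, x.used))
    (by rintro ⟨_, _, _, _⟩ ⟨_, _, _, _⟩ h; simp_all)

instance (A : Type) [Finite A] : Finite (Ctl A) :=
  Finite.of_injective (β := Option (Op A) × Bool × Bool × Bool × Fin 5)
    (fun q => (q.sym, q.arrow, q.hd, q.prev, q.count))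
    (by rintro ⟨_, _, _, _, _⟩ ⟨_, _, _, _, _⟩ h; simp_all)

variable {A : Type} [DecidableEq A]

/-- Whether a symbol is an arrow. -/
def isArrow : Option (Op A) → Bool
  | some .left => true
  | some .right => true
  | _ => false

/-- Whether a symbol is the backspace. -/
def isBackspace : Option (Op A) → Bool
  | some .backspace => true
  | _ => false

/-- The number `n`, replaced by `4` if it is larger. -/
def cap (n : ℕ) : Fin 5 := ⟨min n 4, by omega⟩

/-- The new mark of a cell in a pass from left to right. -/
def Ctl.fwdMark (q : Ctl A) (x : Cell A) : Bool :=
  match q.sym, x.tag with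
  | none, _ => x.safe
  | some (.letter _), .origin => false
  | some (.letter a), .head b => decide (b = a) && q.hd
  | some (.letter _), .body => q.prev
  | _, _ => x.mark

/-- The transducer of the passes from left to right, which types letters. -/
def Ctl.fwd (q : Ctl A) (x : Cell A) : Ctl A × Cell A :=
  ({ q with
      hd := match x.tag with
        | .body => q.hd
        | _ => x.mark
      prev := x.mark },
    { x with mark := q.fwdMark x })

/-- At the end of a key, all marked cells must be safe. -/
def Ctl.fwdCheck (q : Ctl A) (x : Cell A) : Bool := q.sym.isSome || !x.mark || x.safe

/-- The transducer of the passes from right to left, which carries out backspaces and marks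
(up to) four further cells as used in every row. -/
def Ctl.bwd (q : Ctl A) (x : Cell A) : Ctl A × Cell A :=
  match x.tag with
  | .body =>
    ({ q with prev := x.mark, count := if x.used then q.count else cap (q.count + 1) },
      { x with mark := if isBackspace q.sym then q.prev else x.mark
               used := x.used || decide (q.count ≠ 4) })
  | .head _ =>
    ({ q with hd := x.mark, prev := false, count := 0 },
      { x with mark := if isBackspace q.sym then q.prev || q.hd else x.mark })
  | .origin =>
    ({ q with hd := x.mark, prev := false, count := 0 },
      { x with mark := if isBackspace q.sym then x.mark || q.prev || q.hd else x.mark })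

/-- In every row there must be four further cells. -/
def Ctl.bwdCheck (q : Ctl A) (x : Cell A) : Bool :=
  match x.tag with
  | .body => true
  | _ => decide (q.count = 4)

/-- The verifier for non-universality of `BK` keyboards.  Given an encoded keyboard, it accepts
all certificates if the encoding is wrong.  Otherwise, a certificate stands for a word `w` and a
set of safe positions relative to `w`; it consists of rows, of which the one with index `i` tells
which positions `(i, h)` are safe.  The verifier checks that every key leads from safe positions
to safe positions different from the position of `w` itself, which is the first one of the last
row. -/
def verifier (A : Type) [DecidableEq A] :
    SweepMachine.Data (Option (Op A)) (Bool × Option A) (Cell A) (Ctl A × Bool) where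
  conv z := ⟨z.2.elim .body .head, z.1, z.1, false⟩
  base := ⟨.origin, true, true, false⟩
  init := (⟨none, false, false, false, 0⟩, true)
  read σ q := (⟨σ, q.1.arrow || isArrow σ, false, false, 0⟩, q.2)
  fwd := SweepMachine.withCheck Ctl.fwd Ctl.fwdCheck
  -- Here `q.1.hd` is the mark of the first cell of the last row, the position of `w`.
  turn q := ({ q.1 with hd := false, prev := false, count := 0 },
    q.2 && (q.1.sym.isSome || !q.1.hd))
  bwd := SweepMachine.withCheck Ctl.bwd Ctl.bwdCheck
  answer q := q.1.sym.isSome || q.1.arrow || q.2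

/-- The kind of the position `(i, h)` relative to `w`. -/
def tagAt (w : List A) : ℕ → ℕ → Tag A
  | 0, 0 => .origin
  | i + 1, 0 => w[i]?.elim .body .head
  | _, _ + 1 => .body

/-- The cell of the position `(i, h)`, if `n` gives the lengths of the rows, `s` the safe positions,
`c` the marked ones, and `r` symbols have been read. -/
def cellAt (w : List A) (n : ℕ → ℕ) (s c : ℕ → ℕ → Bool) (r i h : ℕ) : Cell A :=
  ⟨tagAt w i h, s i h, c i h, decide (h ≠ 0 ∧ n i < h + 4 * r)⟩

/-- The row of index `i`. -/
def row (w : List A) (n : ℕ → ℕ) (s c : ℕ → ℕ → Bool) (r i : ℕ) : List (Cell A) :=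
  (List.range (n i + 1)).map (cellAt w n s c r i)

/-- The list of all cells. -/
def grid (w : List A) (n : ℕ → ℕ) (s c : ℕ → ℕ → Bool) (r : ℕ) : List (Cell A) :=
  (List.range (w.length + 1)).flatMap (row w n s c r)

/-- The marks after a pass from left to right. -/
def fwdMarks (w : List A) (s : ℕ → ℕ → Bool) (σ : Option (Op A)) (c : ℕ → ℕ → Bool) :
    ℕ → ℕ → Bool :=
  match σ with
  | none => s
  | some (.letter a) => fun
    | 0, 0 => false
    | i + 1, 0 => decide (w[i]? = some a) && c i 0
    | i, h + 1 => c i h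
  | _ => c

/-- The marks after a pass from right to left. -/
def bwdMarks (w : List A) (n : ℕ → ℕ) (σ : Option (Op A)) (c : ℕ → ℕ → Bool) : ℕ → ℕ → Bool :=
  if isBackspace σ then fun
    | i, 0 => (decide (i = 0) && c i 0) || (decide (1 ≤ n i) && c i 1) ||
        (decide (i + 1 ≤ w.length) && c (i + 1) 0)
    | i, h + 1 => decide (h + 2 ≤ n i) && c i (h + 2)
  else c

/-- The control state in front of the cell of the position `(i, h)` in a pass from left to
right. -/
def fwdCtl (n : ℕ → ℕ) (c : ℕ → ℕ → Bool) (σ : Option (Op A)) (b : Bool) : ℕ → ℕ → Ctl A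
  | 0, 0 => ⟨σ, b, false, false, 0⟩
  | i + 1, 0 => ⟨σ, b, c i 0, c i (n i), 0⟩
  | i, h + 1 => ⟨σ, b, c i 0, c i h, 0⟩

/-- The control state in a pass from right to left when the row of index `i` has been treated. -/
def bwdRowCtl (w : List A) (c : ℕ → ℕ → Bool) (σ : Option (Op A)) (b : Bool) (i : ℕ) : Ctl A :=
  ⟨σ, b, decide (i ≤ w.length) && c i 0, false, 0⟩

/-- The control state in a pass from right to left when the position `(i, h)` has been treated. -/
def bwdCtl (w : List A) (n : ℕ → ℕ) (c : ℕ → ℕ → Bool) (r : ℕ) (σ : Option (Op A)) (b : Bool)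
    (i : ℕ) : ℕ → Ctl A
  | 0 => bwdRowCtl w c σ b i
  | h + 1 => ⟨σ, b, decide (i + 1 ≤ w.length) && c (i + 1) 0,
      decide (h + 1 ≤ n i) && c i (h + 1), cap (n i - h - 4 * r)⟩

omit [DecidableEq A] in
theorem tagAt_head {w : List A} {i : ℕ} (hi : i + 1 ≤ w.length) :
    tagAt w (i + 1) 0 = .head (w[i]) := by
  simp [tagAt, List.getElem?_eq_getElem (show i < w.length by omega)]

theorem fwd_cellAt (w : List A) (n : ℕ → ℕ) (s c : ℕ → ℕ → Bool) (r : ℕ) (σ : Option (Op A))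
    (b : Bool) {i : ℕ} (hi : i ≤ w.length) (h : ℕ) :
    (fwdCtl n c σ b i h).fwd (cellAt w n s c r i h) =
      (fwdCtl n c σ b i (h + 1), cellAt w n s (fwdMarks w s σ c) r i h) := by
  match i, h, hi with
  | 0, 0, _ =>
    rcases σ with _ | _ | _ | _ | _ <;>
      simp [Ctl.fwd, Ctl.fwdMark, fwdCtl, cellAt, fwdMarks, tagAt]
  | i + 1, 0, hi =>
    have hw : w[i]? = some w[i] := List.getElem?_eq_getElem _
    rcases σ with _ | _ | _ | _ | _ <;>
      simp [Ctl.fwd, Ctl.fwdMark, fwdCtl, cellAt, fwdMarks, tagAt_head hi, hw]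
  | 0, h + 1, _ =>
    rcases σ with _ | _ | _ | _ | _ <;>
      simp [Ctl.fwd, Ctl.fwdMark, fwdCtl, cellAt, fwdMarks, tagAt]
  | i + 1, h + 1, _ =>
    rcases σ with _ | _ | _ | _ | _ <;>
      simp [Ctl.fwd, Ctl.fwdMark, fwdCtl, cellAt, fwdMarks, tagAt]

theorem cap_succ (n : ℕ) : cap ((cap n : Fin 5) + 1 : ℕ) = cap (n + 1) := by
  simp only [cap, Fin.mk.injEq]; omega

theorem cap_eq_four (n : ℕ) : cap n = 4 ↔ 4 ≤ n := by
  simp only [cap, Fin.ext_iff]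
  change min n 4 = 4 ↔ _
  omega

omit [DecidableEq A] in
theorem bwd_cellAt (w : List A) (n : ℕ → ℕ) (s c : ℕ → ℕ → Bool) (r : ℕ) (σ : Option (Op A))
    (b : Bool) {i h : ℕ} (hi : i ≤ w.length) (hh : h ≤ n i) :
    (bwdCtl w n c r σ b i (h + 1)).bwd (cellAt w n s c r i h) =
      (bwdCtl w n c r σ b i h, cellAt w n s (bwdMarks w n σ c) (r + 1) i h) := by
  match h, hh with
  | 0, _ =>
    cases i with
    | zero => by_cases hσ : isBackspace σ <;>
        simp [Ctl.bwd, bwdCtl, bwdRowCtl, cellAt, bwdMarks, tagAt, hσ]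
    | succ i => by_cases hσ : isBackspace σ <;>
        simp [Ctl.bwd, bwdCtl, bwdRowCtl, cellAt, bwdMarks, tagAt_head hi, hσ, Nat.lt_of_succ_le hi]
  | h + 1, hh =>
    have ht : tagAt w i (h + 1) = .body := by cases i <;> rfl
    have h₁ : (if n i < h + 1 + 4 * r then cap (n i - (h + 1) - 4 * r)
        else cap ((cap (n i - (h + 1) - 4 * r) : Fin 5) + 1 : ℕ)) = cap (n i - h - 4 * r) := by
      rw [cap_succ]
      split_ifs <;> congr 1 <;> omega
    have h₂ : n i < h + 1 + 4 * r ∨ ¬ 4 ≤ n i - (h + 1) - 4 * r ↔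
        n i < h + 1 + 4 * (r + 1) := by omega
    have h₃ : h < n i := hh
    by_cases hσ : isBackspace σ
    · simp [Ctl.bwd, bwdCtl, cellAt, bwdMarks, ht, hσ, h₁, ← h₂, h₃, cap_eq_four]
      rfl
    · simp [Ctl.bwd, bwdCtl, cellAt, bwdMarks, ht, hσ, h₁, ← h₂, h₃, cap_eq_four]

/-- The check at the end of a key: the marked positions are safe, and do not contain the position
of `w`. -/
def Good (w : List A) (n : ℕ → ℕ) (s c : ℕ → ℕ → Bool) : Prop :=
  (∀ i ≤ w.length, ∀ h ≤ n i, c i h = true → s i h = true) ∧ c w.length 0 = false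

theorem pass_fwd_grid (w : List A) (n : ℕ → ℕ) (s c : ℕ → ℕ → Bool) (r : ℕ) (σ : Option (Op A))
    (a b : Bool) :
    SweepMachine.pass (SweepMachine.withCheck Ctl.fwd Ctl.fwdCheck) (fwdCtl n c σ a 0 0, b)
      (grid w n s c r) [] =
    ((fwdCtl n c σ a (w.length + 1) 0, b && (List.range (w.length + 1)).all fun i =>
      (List.range (n i + 1)).all fun h => σ.isSome || !c i h || s i h),
      (grid w n s (fwdMarks w s σ c) r).reverse) := by
  have h := SweepMachine.pass_flatMap_range (st := fun i => fwdCtl n c σ a i 0)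
    (F := SweepMachine.withCheck Ctl.fwd Ctl.fwdCheck) (N := w.length + 1)
    (R := row w n s c r) (R' := row w n s (fwdMarks w s σ c) r)
    (e := fun i => (List.range (n i + 1)).all fun h => σ.isSome || !c i h || s i h)
    (fun i hi b acc => ?_) b []
  · rw [List.append_nil] at h
    exact h
  · have h := SweepMachine.pass_map_range (chk := Ctl.fwdCheck) (st := fwdCtl n c σ a i)
      (fun j (_ : j < n i + 1) => fwd_cellAt w n s c r σ a (Nat.lt_succ_iff.1 hi) j) b acc
    have e : ∀ j, (fwdCtl n c σ a i j).fwdCheck (cellAt w n s c r i j) =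
        (σ.isSome || !c i j || s i j) := by
      intro j
      rcases i with _ | i <;> rcases j with _ | j <;> rfl
    simp only [e] at h
    refine h.trans ?_
    cases i <;> rfl

omit [DecidableEq A] in
theorem pass_bwd_grid (w : List A) (n : ℕ → ℕ) (s c : ℕ → ℕ → Bool) (r : ℕ) (σ : Option (Op A))
    (a b : Bool) :
    SweepMachine.pass (SweepMachine.withCheck Ctl.bwd Ctl.bwdCheck)
      (bwdRowCtl w c σ a (w.length + 1), b) (grid w n s c r).reverse [] =
    ((bwdRowCtl w c σ a 0, b && (List.range (w.length + 1)).all fun i =>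
      decide (4 * (r + 1) ≤ n i)), grid w n s (bwdMarks w n σ c) (r + 1)) := by
  have h := SweepMachine.pass_reverse_flatMap_range (st := bwdRowCtl w c σ a)
    (F := SweepMachine.withCheck Ctl.bwd Ctl.bwdCheck) (N := w.length + 1)
    (R := row w n s c r) (R' := row w n s (bwdMarks w n σ c) (r + 1))
    (e := fun i => decide (4 * (r + 1) ≤ n i)) (fun i hi b acc => ?_) b []
  · rw [List.append_nil] at h
    exact h
  · have h := SweepMachine.pass_reverse_map_range (chk := Ctl.bwdCheck) (st := bwdCtl w n c r σ a i)
      (fun j (hj : j < n i + 1) =>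
        bwd_cellAt w n s c r σ a (Nat.lt_succ_iff.1 hi) (Nat.lt_succ_iff.1 hj)) b acc
    have e : (List.range (n i + 1)).all (fun j =>
        (bwdCtl w n c r σ a i (j + 1)).bwdCheck (cellAt w n s c r i j)) =
        decide (4 * (r + 1) ≤ n i) := by
      rw [List.range_succ_eq_map, List.all_cons, List.all_map]
      have e₀ : (bwdCtl w n c r σ a i (0 + 1)).bwdCheck (cellAt w n s c r i 0) =
          decide (4 * (r + 1) ≤ n i) := by
        have : cap (n i - 4 * r) = 4 ↔ 4 * (r + 1) ≤ n i := by rw [cap_eq_four]; omega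
        rcases i with _ | i
        · simp [Ctl.bwdCheck, bwdCtl, cellAt, tagAt, this]
        · simp [Ctl.bwdCheck, bwdCtl, cellAt, tagAt_head (Nat.lt_succ_iff.1 hi), this]
      have e₁ : ∀ j, (bwdCtl w n c r σ a i (j + 1 + 1)).bwdCheck (cellAt w n s c r i (j + 1)) =
          true := by
        intro j
        rcases i with _ | i <;> rfl
      simp only [e₀, Function.comp_def, Nat.succ_eq_add_one, e₁]
      simp
    have e' : bwdCtl w n c r σ a i (n i + 1) = bwdRowCtl w c σ a (i + 1) := by
      simp [bwdCtl, bwdRowCtl, cap]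
    rw [e, e'] at h
    exact h

theorem sweep_grid (w : List A) (n : ℕ → ℕ) (s c : ℕ → ℕ → Bool) (r : ℕ) (σ : Option (Op A))
    (q : Ctl A) (b : Bool) :
    ∃ (q' : Ctl A) (b' : Bool), (verifier A).sweep ((q, b), grid w n s c r) σ =
        ((q', b'), grid w n s (bwdMarks w n σ (fwdMarks w s σ c)) (r + 1)) ∧
      q'.sym = σ ∧ q'.arrow = (q.arrow || isArrow σ) ∧
      (b' = true ↔ b = true ∧ (σ = none → Good w n s c) ∧
        ∀ i ≤ w.length, 4 * (r + 1) ≤ n i) := by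
  have h₁ := pass_fwd_grid w n s c r σ (q.arrow || isArrow σ) b
  have h₂ := pass_bwd_grid w n s (fwdMarks w s σ c) r σ (q.arrow || isArrow σ)
    ((b && (List.range (w.length + 1)).all fun i =>
      (List.range (n i + 1)).all fun h => σ.isSome || !c i h || s i h) &&
      (σ.isSome || !c w.length 0))
  have e : bwdRowCtl w (fwdMarks w s σ c) σ (q.arrow || isArrow σ) (w.length + 1) =
      ⟨σ, q.arrow || isArrow σ, false, false, 0⟩ := by
    simp [bwdRowCtl]
  rw [e] at h₂
  refine ⟨_, _, Eq.trans ?_ h₂, rfl, rfl, ?_⟩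
  · unfold SweepMachine.Data.sweep
    dsimp only
    erw [h₁]
    rfl
  · simp only [Bool.and_eq_true, List.all_eq_true, List.mem_range, Nat.lt_succ_iff,
      decide_eq_true_eq, Good]
    cases σ with
    | none => simp [and_assoc, imp_iff_not_or]
    | some σ => simp

end Keyboards

namespace Keyboards

variable {A : Type}

/-! ### Encodings of keyboards -/

theorem encodeKeys_append (l l' : List (Key A)) :
    encodeKeys (l ++ l') = encodeKeys l ++ encodeKeys l' := by
  simp [encodeKeys]

theorem encodeKeys_cons (t : Key A) (l : List (Key A)) :
    encodeKeys (t :: l) = t.map some ++ none :: encodeKeys l := by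
  simp [encodeKeys]

theorem exists_eq_encodeKeys_append (x : List (Option (Op A))) :
    ∃ (l : List (Key A)) (t : Key A), x = encodeKeys l ++ t.map some := by
  induction x using List.reverseRecOn with
  | nil => exact ⟨[], [], rfl⟩
  | append_singleton x σ ih =>
    obtain ⟨l, t, rfl⟩ := ih
    cases σ with
    | none => exact ⟨l ++ [t], [], by simp [encodeKeys]⟩
    | some σ => exact ⟨l, t ++ [σ], by simp⟩

theorem exists_eq_of_encodeKeys_eq {l : List (Key A)} {p z : List (Option (Op A))}
    (h : encodeKeys l = p ++ none :: z) :
    ∃ (l₁ l₂ : List (Key A)) (t : Key A), l = l₁ ++ t :: l₂ ∧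
      p = encodeKeys l₁ ++ t.map some := by
  induction l generalizing p with
  | nil => simp [encodeKeys] at h
  | cons t l ih =>
    rw [encodeKeys_cons, List.append_eq_append_iff] at h
    rcases h with ⟨a, rfl, h⟩ | ⟨a, ht, h⟩
    · rcases a with _ | ⟨σ, a⟩
      · exact ⟨[], l, t, rfl, by simp [encodeKeys]⟩
      · simp only [List.cons_append, List.cons.injEq] at h
        obtain ⟨rfl, h⟩ := h
        obtain ⟨l₁, l₂, t', rfl, rfl⟩ := ih h
        exact ⟨t :: l₁, l₂, t', rfl, by simp [encodeKeys_cons]⟩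
    · rcases a with _ | ⟨σ, a⟩
      · rw [List.append_nil] at ht
        exact ⟨[], l, t, rfl, by simp [encodeKeys, ht]⟩
      · simp only [List.cons_append, List.cons.injEq] at h
        obtain ⟨rfl, -⟩ := h
        have : (none : Option (Op A)) ∈ t.map some := by rw [ht]; simp
        simp at this

theorem length_lt_length_encodeKeys {l : List (Key A)} {t : Key A} (ht : t ∈ l) :
    t.length < (encodeKeys l).length := by
  obtain ⟨l₁, l₂, rfl⟩ := List.append_of_mem ht
  rw [encodeKeys_append, encodeKeys_cons]
  simp
  omega

theorem mem_encodeKeys_some {l : List (Key A)} {σ : Op A} :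
    some σ ∈ encodeKeys l ↔ ∃ t ∈ l, σ ∈ t := by
  simp [encodeKeys]

theorem getLast?_encodeKeys (l : List (Key A)) : (encodeKeys l).getLast?.getD none = none := by
  rcases List.eq_nil_or_concat l with rfl | ⟨l, t, rfl⟩
  · rfl
  · rw [List.concat_eq_append, encodeKeys_append, encodeKeys_cons]
    simp [encodeKeys]

/-! ### Correctness of the verifier -/

section Marks

variable [DecidableEq A]

/-- The marks after the symbols of `x`. -/
def marks (w : List A) (n : ℕ → ℕ) (s : ℕ → ℕ → Bool) (x : List (Option (Op A)))
    (c : ℕ → ℕ → Bool) : ℕ → ℕ → Bool :=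
  x.foldl (fun c σ => bwdMarks w n σ (fwdMarks w s σ c)) c

theorem marks_append (w : List A) (n : ℕ → ℕ) (s : ℕ → ℕ → Bool) (x y : List (Option (Op A)))
    (c : ℕ → ℕ → Bool) : marks w n s (x ++ y) c = marks w n s y (marks w n s x c) := by
  simp [marks]

theorem marks_encodeKeys (w : List A) (n : ℕ → ℕ) (s : ℕ → ℕ → Bool) (l : List (Key A)) :
    marks w n s (encodeKeys l) s = s := by
  rcases List.eq_nil_or_concat l with rfl | ⟨l, t, rfl⟩
  · rfl
  · rw [List.concat_eq_append, encodeKeys_append, encodeKeys_cons, marks_append, marks_append]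
    rfl

theorem foldl_sweep_grid (w : List A) (n : ℕ → ℕ) (s : ℕ → ℕ → Bool) (x : List (Option (Op A)))
    (c : ℕ → ℕ → Bool) (r : ℕ) (q : Ctl A) (b : Bool) :
    ∃ (q' : Ctl A) (b' : Bool),
      (x.foldl (verifier A).sweep ((q, b), grid w n s c r)).1 = (q', b') ∧
      q'.sym = x.getLast?.getD q.sym ∧ q'.arrow = (q.arrow || x.any isArrow) ∧
      (b' = true ↔ b = true ∧ (∀ p z, x = p ++ none :: z → Good w n s (marks w n s p c)) ∧
        (x ≠ [] → ∀ i ≤ w.length, 4 * (r + x.length) ≤ n i)) := by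
  induction x generalizing c r q b with
  | nil => exact ⟨q, b, rfl, by simp, by simp, by simp⟩
  | cons σ x ih =>
    obtain ⟨q₁, b₁, e, h₁, h₂, h₃⟩ := sweep_grid w n s c r σ q b
    obtain ⟨q₂, b₂, e', h₁', h₂', h₃'⟩ :=
      ih (bwdMarks w n σ (fwdMarks w s σ c)) (r + 1) q₁ b₁
    refine ⟨q₂, b₂, ?_, ?_, ?_, ?_⟩
    · rw [List.foldl_cons, e, e']
    · rw [h₁', h₁]
      cases x with
      | nil => rfl
      | cons τ x => simp [List.getLast?_cons]
    · rw [h₂', h₂, List.any_cons, Bool.or_assoc]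
    · rw [h₃', h₃]
      constructor
      · rintro ⟨⟨hb, hg, hn⟩, hg', hn'⟩
        refine ⟨hb, ?_, fun _ i hi => ?_⟩
        · rintro (_ | ⟨τ, p⟩) z hx
          · simp only [List.nil_append, List.cons.injEq] at hx
            exact hg hx.1
          · simp only [List.cons_append, List.cons.injEq] at hx
            obtain ⟨rfl, hx⟩ := hx
            exact hg' p z hx
        · rw [List.length_cons]
          rcases eq_or_ne x [] with rfl | hx
          · exact hn i hi
          · have := hn' hx i hi
            omega
      · rintro ⟨hb, hg, hn⟩
        have hn₁ := hn (by simp)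
        refine ⟨⟨hb, ?_, fun i hi => ?_⟩, fun p z hx => ?_, fun _ i hi => ?_⟩
        · rintro rfl
          exact hg [] x rfl
        · have := hn₁ i hi
          rw [List.length_cons] at this
          omega
        · subst hx
          exact hg (σ :: p) z rfl
        · have := hn₁ i hi
          rw [List.length_cons] at this
          omega

/-- What the verifier accepts on a certificate which stands for the word `w` and the set `s`. -/
theorem verdict_eq_true_iff {w : List A} {n : ℕ → ℕ} {s : ℕ → ℕ → Bool}
    {x : List (Option (Op A))} {y : List (Bool × Option A)}
    (hy : (verifier A).cells y = grid w n s s 0) :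
    (verifier A).verdict (x, y) = true ↔ (x.getLast?.getD none).isSome = true ∨
      x.any isArrow = true ∨
      ((∀ p z, x = p ++ none :: z → Good w n s (marks w n s p s)) ∧
        (x ≠ [] → ∀ i ≤ w.length, 4 * x.length ≤ n i)) := by
  obtain ⟨q, b, e, h₁, h₂, h₃⟩ :=
    foldl_sweep_grid w n s x s 0 (verifier A).init.1 (verifier A).init.2
  have e' : (verifier A).verdict (x, y) = (q.sym.isSome || q.arrow || b) := by
    unfold SweepMachine.Data.verdict
    rw [hy]
    erw [e]
    rfl
  have i₁ : (verifier A).init.1.sym = none := rfl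
  have i₂ : (verifier A).init.1.arrow = false := rfl
  have i₃ : (verifier A).init.2 = true := rfl
  rw [i₁] at h₁
  rw [i₂] at h₂
  rw [i₃] at h₃
  rw [e', h₁, h₂, Bool.or_eq_true, Bool.or_eq_true, h₃]
  simp [or_assoc]

omit [DecidableEq A] in
theorem row_congr {w w' : List A} {n n' : ℕ → ℕ} {s s' : ℕ → ℕ → Bool} {i : ℕ}
    (hn : n i = n' i) (h : ∀ h ≤ n i, tagAt w i h = tagAt w' i h ∧ s i h = s' i h) :
    row w n s s 0 i = row w' n' s' s' 0 i := by
  unfold row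
  rw [← hn]
  refine List.map_congr_left fun k hk => ?_
  rw [List.mem_range, Nat.lt_succ_iff] at hk
  simp only [cellAt, (h k hk).1, (h k hk).2, hn]

/-- Every certificate stands for some word and some set of safe positions. -/
theorem exists_cells_eq_grid (y : List (Bool × Option A)) :
    ∃ (w : List A) (n : ℕ → ℕ) (s : ℕ → ℕ → Bool), s 0 0 = true ∧
      (verifier A).cells y = grid w n s s 0 := by
  induction y with
  | nil => exact ⟨[], fun _ => 0, fun _ _ => true, rfl, rfl⟩
  | cons z y ih =>
    obtain ⟨w, n, s, hs, e⟩ := ih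
    obtain ⟨b, o⟩ := z
    have e' : (verifier A).cells ((b, o) :: y) =
        (verifier A).cells y ++ [⟨o.elim .body .head, b, b, false⟩] := by
      simp [SweepMachine.Data.cells]
      rfl
    rw [e', e]
    cases o with
    | none =>
      -- The last row grows by one cell.
      refine ⟨w, fun i => if i = w.length then n i + 1 else n i,
        fun i h => if i = w.length ∧ h = n i + 1 then b else s i h, by simp [hs], ?_⟩
      rw [grid, grid, List.range_succ, List.flatMap_append, List.flatMap_append, List.append_assoc]
      congr 1
      · refine List.flatMap_congr fun i hi => row_congr ?_ ?_
        · rw [List.mem_range] at hi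
          simp [hi.ne]
        · intro h _
          rw [List.mem_range] at hi
          simp [hi.ne]
      · simp only [List.flatMap_cons, List.flatMap_nil, List.append_nil]
        conv_rhs => rw [row]
        simp only [if_true]
        rw [List.range_succ, List.map_append]
        congr 1
        · refine List.map_congr_left fun k hk => ?_
          rw [List.mem_range] at hk
          have : k ≠ n w.length + 1 := hk.ne
          simp only [cellAt, this, and_false, if_false, Cell.mk.injEq, true_and,
            decide_eq_decide, if_true]
          omega
        · have : tagAt w w.length (n w.length + 1) = .body := by cases w <;> rfl
          simp [cellAt, this]
    | some a =>
      -- A new row is started.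
      refine ⟨w ++ [a], fun i => if i = w.length + 1 then 0 else n i,
        fun i h => if i = w.length + 1 then b else s i h, by simp [hs], ?_⟩
      rw [grid, grid, List.length_append, List.length_singleton,
        List.range_succ (n := w.length + 1), List.flatMap_append]
      congr 1
      · refine List.flatMap_congr fun i hi => row_congr ?_ ?_
        · rw [List.mem_range] at hi
          simp [hi.ne]
        · intro h _
          rw [List.mem_range] at hi
          refine ⟨?_, by simp [hi.ne]⟩
          match i, h, hi with
          | 0, 0, _ => rfl
          | i + 1, 0, hi => simp [tagAt, List.getElem?_append_left (show i < w.length by omega)]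
          | 0, h + 1, _ => rfl
          | i + 1, h + 1, _ => rfl
      · simp [row, cellAt, tagAt]

/-- The certificate which stands for `w` and `s`, with rows of lengths given by `n`. -/
def certificate (w : List A) (n : ℕ → ℕ) (s : ℕ → ℕ → Bool) : List (Bool × Option A) :=
  ((List.range (n 0)).map (fun h => (s 0 (h + 1), none)) ++
    (List.range w.length).flatMap fun i => (List.range (n (i + 1) + 1)).map fun h =>
      (s (i + 1) h, if h = 0 then w[i]? else none)).reverse

theorem cells_certificate (w : List A) (n : ℕ → ℕ) (s : ℕ → ℕ → Bool) (hs : s 0 0 = true) :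
    (verifier A).cells (certificate w n s) = grid w n s s 0 := by
  rw [SweepMachine.Data.cells, certificate, List.map_reverse, List.reverse_reverse, grid,
    List.range_succ_eq_map, List.flatMap_cons, row, List.range_succ_eq_map, List.map_cons,
    List.cons_append, List.map_append]
  congr 1
  · rw [cellAt, hs]
    rfl
  · congr 1
    · rw [List.map_map, List.map_map]
      refine List.map_congr_left fun h hh => ?_
      rw [List.mem_range] at hh
      simp only [Function.comp_apply, cellAt, verifier, Cell.mk.injEq]
      refine ⟨rfl, trivial, trivial, ?_⟩
      simp
      omega
    · rw [List.map_flatMap, List.flatMap_map]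
      refine List.flatMap_congr fun i _ => ?_
      rw [row, List.map_map]
      refine List.map_congr_left fun h hh => ?_
      rw [List.mem_range] at hh
      simp only [Function.comp_apply, cellAt, verifier, Cell.mk.injEq]
      refine ⟨?_, trivial, trivial, ?_⟩
      · cases h <;> simp [tagAt]
      · simp
        omega

omit [DecidableEq A] in
theorem length_certificate (w : List A) (k : ℕ) (s : ℕ → ℕ → Bool) :
    (certificate w (fun _ => k) s).length = k + w.length * (k + 1) := by
  simp [certificate, Nat.add_comm]

/-- The marks follow the positions of the contents, as long as the rows are long enough. -/
theorem marks_trackAll {w : List A} {n : ℕ → ℕ} {s : ℕ → ℕ → Bool} (t : Key A)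
    (ht : Op.left ∉ t ∧ Op.right ∉ t) (c : ℕ → ℕ → Bool) (q : ℕ × ℕ) (hq : q.1 ≤ w.length)
    (hn : ∀ i ≤ w.length, q.2 + t.length ≤ n i) (hc : c q.1 q.2 = true) :
    (trackAll w t q).1 ≤ w.length ∧
      marks w n s (t.map some) c (trackAll w t q).1 (trackAll w t q).2 = true := by
  induction t generalizing c q with
  | nil => exact ⟨hq, hc⟩
  | cons σ t ih =>
    simp only [List.mem_cons, not_or] at ht
    have hσ : (track w σ q).1 ≤ w.length ∧ bwdMarks w n (some σ) (fwdMarks w s (some σ) c)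
        (track w σ q).1 (track w σ q).2 = true := by
      obtain ⟨i, k⟩ := q
      have hni := hn i hq
      simp only [List.length_cons] at hni hq hc
      cases σ with
      | left => exact absurd rfl ht.1.1
      | right => exact absurd rfl ht.2.1
      | letter a =>
        cases k with
        | zero =>
          by_cases ha : w[i]? = some a
          · have := (List.getElem?_eq_some_iff.1 ha).1
            simp [track, ha, fwdMarks, bwdMarks, isBackspace, hc]
            omega
          · simp [track, ha, fwdMarks, bwdMarks, isBackspace, hc, hq]
        | succ k => exact ⟨hq, by cases i <;> exact hc⟩
      | backspace =>
        cases k with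
        | zero =>
          cases i with
          | zero => simp [track, fwdMarks, bwdMarks, isBackspace, hc]
          | succ i =>
            simp [track, fwdMarks, bwdMarks, isBackspace, hc, hq]
            omega
        | succ k =>
          refine ⟨hq, ?_⟩
          cases k with
          | zero =>
            have : 1 ≤ n i := by omega
            simp [track, fwdMarks, bwdMarks, isBackspace, hc, this]
          | succ k =>
            have : k + 2 ≤ n i := by omega
            simp [track, fwdMarks, bwdMarks, isBackspace, hc, this]
    refine ih ⟨ht.1.2, ht.2.2⟩ _ (track w σ q) hσ.1 (fun i hi => ?_) hσ.2
    have h₁ := hn i hi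
    have h₂ := track_snd_le w σ q
    rw [List.length_cons] at h₁
    omega

/-- The content `u` begins with the first `q.1` letters of `w`, which are followed by `q.2` further
letters. -/
def Fits (w u : List A) (q : ℕ × ℕ) : Prop :=
  q.1 ≤ w.length ∧ ∃ z, u = w.take q.1 ++ z ∧ z.length = q.2

/-- All marks are positions which fit some content. -/
theorem exists_fits_of_marks {w : List A} {n : ℕ → ℕ} {s : ℕ → ℕ → Bool} {R : Set (List A)}
    (t : Key A) (ht : Op.left ∉ t ∧ Op.right ∉ t)
    (hs : ∀ i ≤ w.length, ∀ h, s i h = true → ∃ u ∈ R, Fits w u (i, h)) :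
    ∀ i ≤ w.length, ∀ h, marks w n s (t.map some) s i h = true →
      ∃ u ∈ R, Fits w (writeAll t u) (i, h) := by
  induction t using List.reverseRecOn with
  | nil => exact hs
  | append_singleton t σ ih =>
    simp only [List.mem_append, List.mem_singleton, not_or] at ht
    replace ih := ih ⟨ht.1.1, ht.2.1⟩
    intro i hi h hc
    rw [List.map_append, marks_append] at hc
    generalize marks w n s (t.map some) s = c at ih hc
    simp only [writeAll_concat]
    cases σ with
    | left => exact absurd rfl ht.1.2
    | right => exact absurd rfl ht.2.2
    | letter a =>
      match i, h with
      | 0, 0 => simp [marks, bwdMarks, fwdMarks, isBackspace] at hc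
      | i + 1, 0 =>
        simp only [marks, bwdMarks, fwdMarks, isBackspace, List.map_cons, List.map_nil,
          List.foldl_cons, List.foldl_nil, Bool.false_eq_true, if_false, Bool.and_eq_true,
          decide_eq_true_eq] at hc
        obtain ⟨u, hu, -, z, e, hz⟩ := ih i (by omega) 0 hc.2
        refine ⟨u, hu, hi, [], ?_, rfl⟩
        obtain rfl := List.length_eq_zero_iff.1 hz
        obtain ⟨hlt, rfl⟩ := List.getElem?_eq_some_iff.1 hc.1
        rw [e]
        simp [Op.write]
      | 0, h + 1 =>
        obtain ⟨u, hu, -, z, e, hz⟩ := ih 0 hi h hc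
        exact ⟨u, hu, hi, z ++ [a], by simp [e, Op.write], by simpa using hz⟩
      | i + 1, h + 1 =>
        obtain ⟨u, hu, -, z, e, hz⟩ := ih (i + 1) hi h hc
        exact ⟨u, hu, hi, z ++ [a], by rw [e, Op.write, List.append_assoc], by simpa using hz⟩
    | backspace =>
      -- Removing a letter which does not belong to the common prefix.
      have hpop : ∀ k, c i (k + 1) = true → ∃ u ∈ R, Fits w (Op.backspace.write (writeAll t u))
          (i, k) := by
        intro k hk
        obtain ⟨u, hu, -, z, e, hz⟩ := ih i hi (k + 1) hk
        have hne : z ≠ [] := by rintro rfl; simp at hz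
        refine ⟨u, hu, hi, z.dropLast, ?_, by simp [hz]⟩
        rw [e, Op.write, List.dropLast_append_of_ne_nil hne]
      cases h with
      | succ h =>
        simp only [marks, bwdMarks, fwdMarks, isBackspace, List.map_cons, List.map_nil,
          List.foldl_cons, List.foldl_nil, if_true, Bool.and_eq_true] at hc
        exact hpop _ hc.2
      | zero =>
        simp only [marks, bwdMarks, fwdMarks, isBackspace, List.map_cons, List.map_nil,
          List.foldl_cons, List.foldl_nil, if_true, Bool.or_eq_true, Bool.and_eq_true,
          decide_eq_true_eq] at hc
        rcases hc with (⟨rfl, hc⟩ | ⟨-, hc⟩) | ⟨hlt, hc⟩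
        · obtain ⟨u, hu, -, z, e, hz⟩ := ih 0 hi 0 hc
          obtain rfl := List.length_eq_zero_iff.1 hz
          exact ⟨u, hu, hi, [], by simp [e, Op.write], rfl⟩
        · exact hpop 0 hc
        · obtain ⟨u, hu, -, z, e, hz⟩ := ih (i + 1) hlt 0 hc
          obtain rfl := List.length_eq_zero_iff.1 hz
          refine ⟨u, hu, hi, [], ?_, rfl⟩
          rw [e, Op.write, List.append_nil, dropLast_take hlt]
          simp

end Marks

theorem isArrow_eq_true_iff {σ : Option (Op A)} :
    isArrow σ = true ↔ σ = some .left ∨ σ = some .right := by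
  rcases σ with _ | _ | _ | _ | _ <;> simp [isArrow]

/-- The encodings of universal keyboards are rejected with every certificate. -/
theorem verdict_ne_true_of_mem [DecidableEq A] {x : List (Option (Op A))}
    (hx : x ∈ bkUniversality A) (y : List (Bool × Option A)) :
    (verifier A).verdict (x, y) ≠ true := by
  obtain ⟨K, l, hl, rfl, hK, hU⟩ := hx
  obtain ⟨w, n, s, hs, hy⟩ := exists_cells_eq_grid y
  rw [Ne, verdict_eq_true_iff hy, getLast?_encodeKeys]
  rintro (h | h | ⟨hg, hn⟩)
  · simp at h
  · simp only [List.any_eq_true, isArrow_eq_true_iff] at h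
    obtain ⟨_, hσ, rfl | rfl⟩ := h
    · obtain ⟨t, ht, h⟩ := mem_encodeKeys_some.1 hσ
      exact (hK t ((hl t).1 ht)).1 h
    · obtain ⟨t, ht, h⟩ := mem_encodeKeys_some.1 hσ
      exact (hK t ((hl t).1 ht)).2 h
  · obtain ⟨τ, h₀, hτ, e⟩ := hK.mem_language_iff.1 (hU w)
    have hM : ∀ t ∈ K, t.length ≤ K.normInf := fun t ht => Finset.le_sup (f := List.length) ht
    have hlen : 4 * K.normInf ≤ 4 * (encodeKeys l).length :=
      Nat.mul_le_mul_left 4 (Finset.sup_le fun t ht =>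
        (length_lt_length_encodeKeys ((hl t).2 ht)).le)
    have hne : encodeKeys l ≠ [] := by
      obtain ⟨t, τ, rfl⟩ := List.exists_cons_of_ne_nil h₀
      have := length_lt_length_encodeKeys ((hl t).2 (hτ t (by simp)))
      exact List.ne_nil_of_length_pos (by omega)
    replace hn := hn hne
    -- All positions reached at heights of at most `3 * ‖K‖∞` are safe and differ from that of `w`.
    have key : ∀ t ∈ K, ∀ q : ℕ × ℕ, q.1 ≤ w.length → q.2 ≤ 3 * K.normInf → s q.1 q.2 = true →
        (trackAll w t q).1 ≤ w.length ∧ s (trackAll w t q).1 (trackAll w t q).2 = true ∧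
          trackAll w t q ≠ (w.length, 0) := by
      intro t ht q hq hq' hsq
      obtain ⟨l₁, l₂, rfl⟩ := List.append_of_mem ((hl t).2 ht)
      have hgood := hg (encodeKeys l₁ ++ t.map some) (encodeKeys l₂)
        (by rw [encodeKeys_append, encodeKeys_cons, List.append_assoc])
      rw [marks_append, marks_encodeKeys] at hgood
      have hMt := hM t ht
      obtain ⟨h₁, h₂⟩ := marks_trackAll (n := n) (s := s) t (hK t ht) s q hq
        (fun i hi => by have := hn i hi; omega) hsq
      have h₃ := trackAll_snd_le w t q
      refine ⟨h₁, hgood.1 _ h₁ _ (by have := hn _ h₁; omega) h₂, fun h => ?_⟩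
      rw [h] at h₂
      exact absurd (hgood.2.symm.trans h₂) (by simp)
    have safe : ∀ q, LowReach K w (3 * K.normInf) q →
        q.1 ≤ w.length ∧ s q.1 q.2 = true ∧ q ≠ (w.length, 0) := by
      intro q hq
      induction hq with
      | first t ht => exact key t ht (0, 0) (Nat.zero_le _) (Nat.zero_le _) hs
      | step t ht q hq _ ih => exact key t ht q ih.1 hq ih.2.1
    have hpos := (isPos_nil w).writeAll τ.flatten
    rw [e] at hpos
    have hend := hpos.eq_of_self
    have hlow := lowReach_of_trackAll hM h₀ hτ (w := w) (by rw [hend]; exact Nat.zero_le _)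
    exact (safe _ hlow).2.2 hend

/-- All other strings are accepted with a short certificate: the safe positions are those which
fit some reachable content. -/
theorem exists_verdict_of_notMem [DecidableEq A] {x : List (Option (Op A))}
    (hx : x ∉ bkUniversality A) : ∃ y : List (Bool × Option A),
      y.length ≤ 4 * x.length + (x.length + 1) * (4 * x.length + 1) ∧
      (verifier A).verdict (x, y) = true := by
  classical
  by_cases hvalid : (x.getLast?.getD none).isSome = true ∨ x.any isArrow = true
  · obtain ⟨w, n, s, -, hy⟩ := exists_cells_eq_grid ([] : List (Bool × Option A))
    refine ⟨[], Nat.zero_le _, (verdict_eq_true_iff hy).2 ?_⟩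
    tauto
  · obtain ⟨l, t, rfl⟩ := exists_eq_encodeKeys_append x
    rw [not_or] at hvalid
    obtain ⟨hlast, harrow⟩ := hvalid
    obtain rfl : t = [] := by
      rcases List.eq_nil_or_concat t with rfl | ⟨t, σ, rfl⟩
      · rfl
      · simp at hlast
    simp only [List.map_nil, List.append_nil] at *
    have hl : ∀ t, t ∈ l ↔ t ∈ l.toFinset := fun t => List.mem_toFinset.symm
    have hK : AutomaticKeyboard.IsBK l.toFinset := by
      intro t ht
      simp only [List.any_eq_true, isArrow_eq_true_iff, not_exists, not_and] at harrow
      exact ⟨fun h => harrow _ (mem_encodeKeys_some.2 ⟨t, (hl t).2 ht, h⟩) (.inl rfl),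
        fun h => harrow _ (mem_encodeKeys_some.2 ⟨t, (hl t).2 ht, h⟩) (.inr rfl)⟩
    have hU : ¬ AutomaticKeyboard.Universal l.toFinset := fun h => hx ⟨_, l, hl, rfl, hK, h⟩
    obtain ⟨w, hw, hwL⟩ : ∃ w : List A, w.length ≤ AutomaticKeyboard.normInf l.toFinset + 1 ∧
        w ∉ AutomaticKeyboard.language l.toFinset := by
      by_contra h
      push Not at h
      exact hU (hK.universal_of_short h)
    have hM : AutomaticKeyboard.normInf l.toFinset ≤ (encodeKeys l).length :=
      Finset.sup_le fun t ht => (length_lt_length_encodeKeys ((hl t).2 ht)).le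
    set N := (encodeKeys l).length with hN
    set R : Set (List A) := {u | ∃ τ : List (Key A), (∀ t ∈ τ, t ∈ l) ∧ writeAll τ.flatten [] = u}
      with hR
    set s : ℕ → ℕ → Bool := fun i h => decide (∃ u ∈ R, Fits w u (i, h)) with hs
    have hs₀ : s 0 0 = true :=
      decide_eq_true ⟨[], ⟨[], by simp, rfl⟩, Nat.zero_le _, [], rfl, rfl⟩
    refine ⟨certificate w (fun _ => 4 * N) s, ?_, (verdict_eq_true_iff
      (cells_certificate w _ s hs₀)).2 (.inr (.inr ⟨?_, fun _ _ _ => le_rfl⟩))⟩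
    · rw [length_certificate]
      gcongr
      omega
    · intro p z hp
      obtain ⟨l₁, l₂, t, hlt, rfl⟩ := exists_eq_of_encodeKeys_eq hp
      have htl : t ∈ l := by rw [hlt]; simp
      rw [marks_append, marks_encodeKeys]
      have hfit := exists_fits_of_marks (n := fun _ => 4 * N) (s := s) (R := R) t
        (hK t ((hl t).1 htl)) (fun i _ h hi => of_decide_eq_true hi)
      -- Contents after a key are reachable by a non-empty sequence of keys.
      have hstep : ∀ u ∈ R, ∃ τ : List (Key A), τ ≠ [] ∧ (∀ t ∈ τ, t ∈ l) ∧
          writeAll τ.flatten [] = writeAll t u := by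
        rintro _ ⟨τ, hτ, rfl⟩
        refine ⟨τ ++ [t], by simp, ?_, ?_⟩
        · intro t' ht'
          rcases List.mem_append.1 ht' with h | h
          · exact hτ t' h
          · rwa [List.mem_singleton.1 h]
        · rw [List.flatten_append, writeAll_append]
          simp
      refine ⟨fun i hi h _ hc => ?_, ?_⟩
      · obtain ⟨u, hu, hfu⟩ := hfit i hi h hc
        obtain ⟨τ, -, hτ, e⟩ := hstep u hu
        exact decide_eq_true ⟨_, ⟨τ, hτ, e⟩, hfu⟩
      · by_contra hc
        rw [Bool.not_eq_false] at hc
        obtain ⟨u, hu, -, z', e, hz⟩ := hfit _ le_rfl _ hc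
        obtain ⟨τ, hτ₀, hτ, e'⟩ := hstep u hu
        obtain rfl := List.length_eq_zero_iff.1 hz
        refine hwL (hK.mem_language_iff.2 ⟨τ, hτ₀, fun t ht => (hl t).1 (hτ t ht), ?_⟩)
        rw [e', e]
        simp

end Keyboards

theorem mainTheorem12 (A : Type) [Finite A] :
    Complexity.InCoNP (Keyboards.bkUniversality A) ∧
    ∀ K : Keyboards.AutomaticKeyboard A, K.IsBK → ¬ K.Universal →
      ∃ w : List A, w.length ≤ K.normInf + 1 ∧ w ∉ K.language := by
  classical
  refine ⟨⟨Bool × Option A, inferInstance, 4 * Polynomial.X ^ 2 + 9 * Polynomial.X + 1,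
    (Keyboards.verifier A).verdict, (Keyboards.verifier A).polyTime, fun x => ⟨fun hx => ?_, ?_⟩⟩,
    fun K hK hU => ?_⟩
  · obtain ⟨y, hy, h⟩ := Keyboards.exists_verdict_of_notMem hx
    refine ⟨y, hy.trans (le_of_eq ?_), h⟩
    simp only [Polynomial.eval_add, Polynomial.eval_mul, Polynomial.eval_pow, Polynomial.eval_X,
      Polynomial.eval_ofNat, Polynomial.eval_one]
    ring
  · rintro ⟨y, -, h⟩ hx
    exact Keyboards.verdict_ne_true_of_mem hx y h
  · by_contra h
    push Not at h
    exact hU (hK.universal_of_short h)
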